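/- Let $\mu_0,\mu_1$ be probability measures on $\mathbb{R}$ such that, for $i=0,1$, $\mu_i$ is concentrated on a compact interval $\Omega_i=[a_i,b_i]$ and has there a continuous Lebesgue density $u_i$ with $0<\lambda\le u_i\le\Lambda<\infty$. Let $T_0$ be the Monge map, i.e. $(\mathrm{id}\times T_0)_\#\mu_0$ minimizes $\int\frac12(x-y)^2\,d\pi(x,y)$ over all couplings $\pi$ of $\mu_0$ and $\mu_1$. For $\varepsilon>0$ let $(f_\varepsilon,g_\varepsilon)$ be the potentials of the quadratically regularized transport problem, i.e. continuous functions on $\Omega_0$ and $\Omega_1$ such that $\varphi(x)=\frac12x^2-f_\varepsilon(x)$, $\psi(y)=\frac12y^2-g_\varepsilon(y)$ maximize, over $L^2(\mu_0)\times L^2(\mu_1)$, $$\int\varphi\,d\mu_0+\int\psi\,d\mu_1-\frac1{2\varepsilon}\int\Big(\varphi(x)+\psi(y)-\tfrac12(x-y)^2\Big)_+^2\,d(\mu_0\otimes\mu_1)(x,y);$$ they are unique up to replacing $(f_\varepsilon,g_\varepsilon)$ by $(f_\varepsilon+\alpha,g_\varepsilon-\alpha)$, $\alpha\in\mathbb{R}$.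 For $x\in\Omega_0$ let $$\mathcal{S}_{x,\varepsilon}=\{y\in\Omega_1:\ xy-f_\varepsilon(x)-g_\varepsilon(y)\ge0\},$$ and let $d(\mathcal{S}_{x,\varepsilon},T_0(x))$ be the Hausdorff distance between $\mathcal{S}_{x,\varepsilon}$ and $\{T_0(x)\}$. Then there exist $C,\varepsilon_0>0$, not depending on $\varepsilon$ or on the choice of the potentials, such that for every $0<\varepsilon<\varepsilon_0$: (i) the sections $\mathcal{S}_{x,\varepsilon}$, $x\in\Omega_0$, are nonempty, the function $x\mapsto d(\mathcal{S}_{x,\varepsilon},T_0(x))$ belongs to $L^2(\Omega_0,dx)$, and $$C^{-1}\varepsilon^{1/3}\le\big\|d(\mathcal{S}_{x,\varepsilon},T_0(x))\big\|_{L^2(\Omega_0,dx)}\le C\varepsilon^{1/3};$$ (ii) $f_\varepsilon$ is differentiable on $\Omega_0$ (one-sidedly at the endpoints), $f_\varepsilon'-T_0\in L^2(\Omega_0,dx)$, and $$\|f_\varepsilon'-T_0\|_{L^2(\Omega_0,dx)}\le C\varepsilon^{1/3}.$$ Here $\|h\|_{L^2(\Omega_0,dx)}=\big(\int_{\Omega_0}h(x)^2\,dx\big)^{1/2}$.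 -/

import Mathlib

open MeasureTheory Set

noncomputable section

namespace QOT

/-- `μ` is carried by the compact interval `[a, b]` and has there a continuous Lebesgue density `u`
with `0 < lo ≤ u ≤ hi < ∞`. -/
def HasRegularDensity (μ : Measure ℝ) (a b : ℝ) : Prop :=
  ∃ (u : ℝ → ℝ) (lo hi : ℝ), 0 < lo ∧ ContinuousOn u (Icc a b) ∧
    (∀ x ∈ Icc a b, lo ≤ u x ∧ u x ≤ hi) ∧
    μ = (volume.restrict (Icc a b)).withDensity (fun x => ENNReal.ofReal (u x))

/-- Couplings (transport plans) of `μ₀` and `μ₁`. -/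
def IsCoupling (μ₀ μ₁ : Measure ℝ) (π : Measure (ℝ × ℝ)) : Prop :=
  π.map Prod.fst = μ₀ ∧ π.map Prod.snd = μ₁

/-- The quadratic transport cost `∫ (x - y)² / 2 dπ(x, y)`, as an element of `[0, ∞]`. -/
def transportCost (π : Measure (ℝ × ℝ)) : ENNReal :=
  ∫⁻ z, ENNReal.ofReal ((z.1 - z.2) ^ 2 / 2) ∂π

/-- `T` is an optimal transport (Monge) map: `(id × T)_# μ₀` is a coupling of `μ₀` and `μ₁` and
minimizes the quadratic transport cost among all couplings. -/
def IsMongeMap (μ₀ μ₁ : Measure ℝ) (T : ℝ → ℝ) : Prop :=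
  Measurable T ∧ IsCoupling μ₀ μ₁ (μ₀.map fun x => (x, T x)) ∧
    ∀ π : Measure (ℝ × ℝ), IsCoupling μ₀ μ₁ π →
      transportCost (μ₀.map fun x => (x, T x)) ≤ transportCost π

/-- The objective of the dual of the quadratically regularized transport problem,
`∫ φ dμ₀ + ∫ ψ dμ₁ - 1/(2ε) ∫ (φ(x) + ψ(y) - (x - y)²/2)₊² d(μ₀ ⊗ μ₁)(x, y)`. -/
def dualObjective (μ₀ μ₁ : Measure ℝ) (ε : ℝ) (φ ψ : ℝ → ℝ) : ℝ :=
  (∫ x, φ x ∂μ₀) + (∫ y, ψ y ∂μ₁) -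
    1 / (2 * ε) * ∫ z, (max (φ z.1 + ψ z.2 - (z.1 - z.2) ^ 2 / 2) 0) ^ 2 ∂(μ₀.prod μ₁)

/-- `(φ, ψ) ∈ L²(μ₀) × L²(μ₁)` maximizes the dual objective over `L²(μ₀) × L²(μ₁)`. -/
def IsDualSolution (μ₀ μ₁ : Measure ℝ) (ε : ℝ) (φ ψ : ℝ → ℝ) : Prop :=
  MemLp φ 2 μ₀ ∧ MemLp ψ 2 μ₁ ∧
    ∀ φ' ψ' : ℝ → ℝ, MemLp φ' 2 μ₀ → MemLp ψ' 2 μ₁ →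
      dualObjective μ₀ μ₁ ε φ' ψ' ≤ dualObjective μ₀ μ₁ ε φ ψ

/-- `(f, g)` is the pair of (reparametrized) potentials of the regularized problem: `f` and `g` are
the continuous functions on `Ω₀` and `Ω₁` such that `(x²/2 - f(x), y²/2 - g(y))` solves the dual
problem. The values of `f` and `g` outside `Ω₀` and `Ω₁` are irrelevant. -/
def IsPotentialPair (μ₀ μ₁ : Measure ℝ) (Ω₀ Ω₁ : Set ℝ) (ε : ℝ) (f g : ℝ → ℝ) : Prop :=
  ContinuousOn f Ω₀ ∧ ContinuousOn g Ω₁ ∧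
    IsDualSolution μ₀ μ₁ ε (fun x => x ^ 2 / 2 - f x) (fun y => y ^ 2 / 2 - g y)

/-- The section `{y ∈ Ω₁ : x y - f(x) - g(y) ≥ 0}` of the optimal support. -/
def supportSection (Ω₁ : Set ℝ) (f g : ℝ → ℝ) (x : ℝ) : Set ℝ :=
  {y ∈ Ω₁ | 0 ≤ x * y - f x - g y}

end QOT

end

/-! Put `K(x, y) = (x y - f(x) - g(y))₊` and `ε = r³`. First-order optimality says that `K / ε` is
the density of a coupling with respect to `μ₀ ⊗ μ₁`, so every slice of `K` has mass `ε`. In one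
dimension the Monge map is a.e. the monotone rearrangement `T`, which is bi-Lipschitz because the
densities are bounded above and below. Hence the duality gap `D` of the unregularized Kantorovich
potentials is comparable with `(y - T x)²`.

Both bounds on the sections come from one energy estimate. Quadratic convexity gives `∫ D K + ½ ∫ K²
≤ ε ∫ (D q + (ε/2) q²)` for every bounded coupling density `q` (`RegularPotentials.energy_le`).
Taking `q` to be a product on blocks of width about `r` makes the right side `O(ε r²)`.

Upper bound: `g` is convex, so each slice of `K` is the positive part of a concave function. If such
a bump of mass `ε` reaches a point at distance `d` from `T x`, its second moment about `T x` is at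
least of order `d² ε` (`sq_mul_integral_le`). Integrating in `x` against the energy yields `∫ d² =
O(r²)`.

Lower bound: small `∫ K²` forbids concentration. On a slice, supported in an interval of length `2
d`, `K ≤ K² / (4E) + E`. With `E` of order `r²`, integration gives `ε ≤ ε/2 + C r² ∫ d`, so `∫ d ≥ c
r`, and Cauchy–Schwarz passes to `L²`.

Derivative: the mass constraint on the slices makes the `μ₁`-barycenter of the positivity set a
subgradient of `f`. It is continuous in `x`, hence equals `f'`. As an average over points of the
section it lies within `d` of `T x`. -/

namespace QOT

/-! ### Densities and distribution functions. -/

/-- `μ` is the restriction to `[a, b]` of a measure with a continuous density `u` on the whole line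
such that `lo ≤ u ≤ hi`. -/
structure RegularDensity (μ : Measure ℝ) (a b : ℝ) (u : ℝ → ℝ) (lo hi : ℝ) : Prop where
  lt : a < b
  lo_pos : 0 < lo
  cont : Continuous u
  lo_le : ∀ x, lo ≤ u x
  le_hi : ∀ x, u x ≤ hi
  eq : μ = (volume.restrict (Icc a b)).withDensity (fun x => ENNReal.ofReal (u x))

/-- A probability measure cannot be carried by a null interval, so `a < b`. Extending the density by
its endpoint values keeps continuity and both bounds, and it makes the distribution function a
bijection of the whole line. -/
theorem HasRegularDensity.exists_regularDensity {μ : Measure ℝ} [IsProbabilityMeasure μ] {a b : ℝ}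
    (h : HasRegularDensity μ a b) : ∃ u lo hi, RegularDensity μ a b u lo hi := by
  obtain ⟨u, lo, hi, hlo, hc, hb, rfl⟩ := h
  have hab : a < b := by
    by_contra! hba
    have h0 : (volume.restrict (Icc a b)) = 0 := by
      rw [Measure.restrict_eq_zero, Real.volume_Icc]
      exact ENNReal.ofReal_of_nonpos (by linarith)
    have := IsProbabilityMeasure.ne_zero
      ((volume.restrict (Icc a b)).withDensity (fun x => ENNReal.ofReal (u x)))
    exact this (by rw [h0, withDensity_zero_left])
  refine ⟨IccExtend hab.le (fun x => u x), lo, hi, hab, hlo, ?_, fun x => ?_, fun x => ?_, ?_⟩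
  · exact (continuousOn_iff_continuous_domRestrict.1 hc).Icc_extend'
  · exact (hb _ (projIcc a b hab.le x).2).1
  · exact (hb _ (projIcc a b hab.le x).2).2
  · refine withDensity_congr_ae ?_
    filter_upwards [ae_restrict_mem measurableSet_Icc] with x hx
    rw [IccExtend_of_mem hab.le _ hx]

namespace RegularDensity

variable {μ : Measure ℝ} {a b : ℝ} {u : ℝ → ℝ} {lo hi : ℝ}

theorem hi_pos (h : RegularDensity μ a b u lo hi) : 0 < hi :=
  h.lo_pos.trans_le ((h.lo_le 0).trans (h.le_hi 0))

theorem le_smul (h : RegularDensity μ a b u lo hi) :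
    μ ≤ ENNReal.ofReal hi • volume.restrict (Icc a b) := by
  rw [h.eq, ← withDensity_const]
  exact withDensity_mono (.of_forall fun x => ENNReal.ofReal_le_ofReal (h.le_hi x))

theorem smul_le (h : RegularDensity μ a b u lo hi) :
    ENNReal.ofReal lo • volume.restrict (Icc a b) ≤ μ := by
  rw [h.eq, ← withDensity_const]
  exact withDensity_mono (.of_forall fun x => ENNReal.ofReal_le_ofReal (h.lo_le x))

theorem absolutelyContinuous (h : RegularDensity μ a b u lo hi) :
    μ ≪ volume.restrict (Icc a b) := by
  rw [h.eq]; exact withDensity_absolutelyContinuous _ _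

theorem absolutelyContinuous' (h : RegularDensity μ a b u lo hi) :
    volume.restrict (Icc a b) ≪ μ := by
  refine Measure.AbsolutelyContinuous.trans ?_ h.smul_le.absolutelyContinuous
  refine Measure.AbsolutelyContinuous.mk fun s _ hs => ?_
  simpa [h.lo_pos.not_ge] using hs

theorem ae_mem (h : RegularDensity μ a b u lo hi) : ∀ᵐ x ∂μ, x ∈ Icc a b :=
  h.absolutelyContinuous.ae_le (ae_restrict_mem measurableSet_Icc)

theorem restrict_eq (h : RegularDensity μ a b u lo hi) : μ.restrict (Icc a b) = μ :=
  Measure.restrict_eq_self_of_ae_mem h.ae_mem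

theorem finite_eq_zero (h : RegularDensity μ a b u lo hi) {s : Set ℝ} (hs : s.Finite) :
    μ s = 0 :=
  h.absolutelyContinuous (hs.measure_zero _)

theorem integrable (h : RegularDensity μ a b u lo hi) [IsFiniteMeasure μ] {φ : ℝ → ℝ}
    (hφ : Continuous φ) : Integrable φ μ := by
  rw [← h.restrict_eq]
  exact hφ.continuousOn.integrableOn_compact isCompact_Icc

theorem memLp (h : RegularDensity μ a b u lo hi) [IsFiniteMeasure μ] {φ : ℝ → ℝ}
    (hφ : Continuous φ) : MemLp φ 2 μ := by
  rw [memLp_two_iff_integrable_sq hφ.aestronglyMeasurable]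
  exact h.integrable (hφ.pow 2)

theorem integral_le (h : RegularDensity μ a b u lo hi) {φ : ℝ → ℝ} (hφ : ∀ x, 0 ≤ φ x)
    (hi' : IntegrableOn φ (Icc a b)) : ∫ x, φ x ∂μ ≤ hi * ∫ x in Icc a b, φ x := by
  have := integral_mono_measure h.le_smul (.of_forall hφ) (hi'.smul_measure ENNReal.ofReal_ne_top)
  rwa [integral_smul_measure, ENNReal.toReal_ofReal h.hi_pos.le, smul_eq_mul] at this

theorem le_integral (h : RegularDensity μ a b u lo hi) {φ : ℝ → ℝ} (hφ : ∀ x, 0 ≤ φ x)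
    (hi' : Integrable φ μ) : lo * ∫ x in Icc a b, φ x ≤ ∫ x, φ x ∂μ := by
  have := integral_mono_measure h.smul_le (.of_forall hφ) hi'
  rwa [integral_smul_measure, ENNReal.toReal_ofReal h.lo_pos.le, smul_eq_mul] at this

theorem integrableOn (h : RegularDensity μ a b u lo hi) {φ : ℝ → ℝ}
    (hi' : Integrable φ μ) : IntegrableOn φ (Icc a b) := by
  have := hi'.mono_measure h.smul_le
  refine (integrable_smul_measure ?_ ENNReal.ofReal_ne_top).1 this
  simpa using h.lo_pos

theorem integrable_of_integrableOn (h : RegularDensity μ a b u lo hi) {φ : ℝ → ℝ}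
    (hi' : IntegrableOn φ (Icc a b)) : Integrable φ μ :=
  (hi'.smul_measure ENNReal.ofReal_ne_top).mono_measure h.le_smul

theorem eqOn_of_ae_eq (h : RegularDensity μ a b u lo hi) {φ ψ : ℝ → ℝ} (hφ : Continuous φ)
    (hψ : Continuous ψ) (he : φ =ᵐ[μ] ψ) : EqOn φ ψ (Icc a b) :=
  Measure.eqOn_Icc_of_ae_eq volume h.lt.ne (h.absolutelyContinuous'.ae_le he) hφ.continuousOn
    hψ.continuousOn

theorem continuous_integral (h : RegularDensity μ a b u lo hi) [IsFiniteMeasure μ]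
    {F : ℝ → ℝ → ℝ} (hF : Continuous (Function.uncurry F)) :
    Continuous fun x => ∫ y, F x y ∂μ := by
  have := continuous_parametric_integral_of_continuous (μ := μ) hF (s := Icc a b) isCompact_Icc
  rwa [h.restrict_eq] at this

theorem integrable_prod {ν : Measure ℝ} {c d : ℝ} {v : ℝ → ℝ} {lo' hi' : ℝ}
    [IsFiniteMeasure μ] [IsFiniteMeasure ν] (h : RegularDensity μ a b u lo hi)
    (h' : RegularDensity ν c d v lo' hi') {F : ℝ × ℝ → ℝ} (hF : Continuous F) :
    Integrable F (μ.prod ν) := by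
  have : μ.prod ν = (μ.prod ν).restrict (Icc a b ×ˢ Icc c d) := by
    rw [← Measure.prod_restrict, h.restrict_eq, h'.restrict_eq]
  rw [this]
  exact hF.continuousOn.integrableOn_compact (isCompact_Icc.prod isCompact_Icc)

/-- The distribution function, extended to a bijection of the line. -/
noncomputable def cdf (_ : RegularDensity μ a b u lo hi) (x : ℝ) : ℝ := ∫ t in a..x, u t

theorem hasDerivAt_cdf (h : RegularDensity μ a b u lo hi) (x : ℝ) :
    HasDerivAt h.cdf (u x) x :=
  (h.cont.integral_hasStrictDerivAt a x).hasDerivAt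

theorem continuous_cdf (h : RegularDensity μ a b u lo hi) : Continuous h.cdf :=
  continuous_iff_continuousAt.2 fun x => (h.hasDerivAt_cdf x).continuousAt

theorem mul_le_cdf_sub (h : RegularDensity μ a b u lo hi) {x y : ℝ} (hxy : x ≤ y) :
    lo * (y - x) ≤ h.cdf y - h.cdf x := by
  unfold cdf
  rw [intervalIntegral.integral_interval_sub_left (h.cont.intervalIntegrable _ _)
    (h.cont.intervalIntegrable _ _)]
  have := intervalIntegral.integral_mono_on (f := fun _ => lo) hxy
    (continuous_const.intervalIntegrable _ _)
    (h.cont.intervalIntegrable (μ := volume) _ _) (fun t _ => h.lo_le t)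
  simpa [mul_comm] using this

theorem cdf_sub_le_mul (h : RegularDensity μ a b u lo hi) {x y : ℝ} (hxy : x ≤ y) :
    h.cdf y - h.cdf x ≤ hi * (y - x) := by
  unfold cdf
  rw [intervalIntegral.integral_interval_sub_left (h.cont.intervalIntegrable _ _)
    (h.cont.intervalIntegrable _ _)]
  have := intervalIntegral.integral_mono_on (g := fun _ => hi) hxy
    (h.cont.intervalIntegrable (μ := volume) _ _)
    (continuous_const.intervalIntegrable _ _) (fun t _ => h.le_hi t)
  simpa [mul_comm] using this

theorem strictMono_cdf (h : RegularDensity μ a b u lo hi) : StrictMono h.cdf := fun x y hxy => by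
  have := h.mul_le_cdf_sub hxy.le
  nlinarith [mul_pos h.lo_pos (sub_pos.2 hxy)]

theorem surjective_cdf (h : RegularDensity μ a b u lo hi) : Function.Surjective h.cdf := by
  refine h.continuous_cdf.surjective ?_ ?_
  · refine Filter.tendsto_atTop_mono' _ (f₁ := fun x => lo * (x - 0) + h.cdf 0) ?_ ?_
    · filter_upwards [Filter.eventually_ge_atTop 0] with x hx
      linarith [h.mul_le_cdf_sub hx]
    · refine Filter.tendsto_atTop_add_const_right _ _ ?_
      simpa using Filter.tendsto_id.const_mul_atTop h.lo_pos
  · refine Filter.tendsto_atBot_mono' _ (f₁ := fun x => lo * (x - 0) + h.cdf 0) ?_ ?_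
    · filter_upwards [Filter.eventually_le_atBot 0] with x hx
      linarith [h.mul_le_cdf_sub hx]
    · refine Filter.tendsto_atBot_add_const_right _ _ ?_
      simpa using Filter.tendsto_id.const_mul_atBot h.lo_pos

@[simp] theorem cdf_left (h : RegularDensity μ a b u lo hi) : h.cdf a = 0 := by simp [cdf]

theorem map_cdf_aux (h : RegularDensity μ a b u lo hi) :
    μ.map h.cdf = volume.restrict (Icc 0 (h.cdf b)) := by
  have himg : h.cdf '' Icc a b = Icc 0 (h.cdf b) := by
    have hc := h.continuous_cdf.continuousOn (s := Icc a b)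
    refine Subset.antisymm ?_ ?_
    · rintro _ ⟨x, hx, rfl⟩
      exact ⟨by simpa using h.strictMono_cdf.monotone hx.1, h.strictMono_cdf.monotone hx.2⟩
    · simpa using intermediate_value_Icc h.lt.le hc
  ext s hs
  have hμ : μ (h.cdf ⁻¹' s) = ∫⁻ x in h.cdf ⁻¹' s, ENNReal.ofReal (u x)
      ∂volume.restrict (Icc a b) := by
    rw [← withDensity_apply _ (h.continuous_cdf.measurable hs), ← h.eq]
  rw [Measure.map_apply h.continuous_cdf.measurable hs, hμ, ← lintegral_indicator_one hs, ← himg,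
    lintegral_image_eq_lintegral_abs_deriv_mul measurableSet_Icc
      (fun x _ => (h.hasDerivAt_cdf x).hasDerivWithinAt) h.strictMono_cdf.injective.injOn,
    ← lintegral_indicator (h.continuous_cdf.measurable hs)]
  refine lintegral_congr fun x => ?_
  have hx : 0 ≤ u x := h.lo_pos.le.trans (h.lo_le x)
  by_cases hxs : h.cdf x ∈ s <;> simp [indicator, hxs, abs_of_nonneg hx]

theorem cdf_right (h : RegularDensity μ a b u lo hi) [IsProbabilityMeasure μ] : h.cdf b = 1 := by
  have h1 : (μ.map h.cdf) univ = 1 := by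
    rw [Measure.map_apply h.continuous_cdf.measurable .univ]; simp
  rw [h.map_cdf_aux] at h1
  simpa using h1

theorem map_cdf (h : RegularDensity μ a b u lo hi) [IsProbabilityMeasure μ] :
    μ.map h.cdf = volume.restrict (Icc 0 1) := by
  rw [h.map_cdf_aux, h.cdf_right]

end RegularDensity

/-! ### Bi-Lipschitz pairs and the Kantorovich duality gap. -/

/-- `T` is an increasing bi-Lipschitz bijection of the line with inverse `R`. The derivative of `R`
lies between `m` and `M`. -/
structure BiLipschitzPair (T R : ℝ → ℝ) (m M : ℝ) : Prop where
  m_pos : 0 < m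
  left_inv : ∀ x, R (T x) = x
  right_inv : ∀ y, T (R y) = y
  lower : ∀ y z, y ≤ z → m * (z - y) ≤ R z - R y
  upper : ∀ y z, y ≤ z → R z - R y ≤ M * (z - y)

namespace BiLipschitzPair

variable {T R : ℝ → ℝ} {m M : ℝ}

theorem monotone (h : BiLipschitzPair T R m M) : Monotone R := fun y z hyz => by
  have := h.lower y z hyz
  nlinarith [mul_nonneg h.m_pos.le (sub_nonneg.2 hyz)]

theorem M_pos (h : BiLipschitzPair T R m M) : 0 < M := by
  have := h.lower 0 1 zero_le_one
  have := h.upper 0 1 zero_le_one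
  linarith [h.m_pos]

theorem continuous_inv (h : BiLipschitzPair T R m M) : Continuous R :=
  h.monotone.continuous_of_surjective fun x => ⟨T x, h.left_inv x⟩

theorem monotone_map (h : BiLipschitzPair T R m M) : Monotone T := fun x y hxy => by
  by_contra! hlt
  have := h.lower _ _ hlt.le
  rw [h.left_inv, h.left_inv] at this
  nlinarith [mul_pos h.m_pos (sub_pos.2 hlt)]

theorem continuous_map (h : BiLipschitzPair T R m M) : Continuous T :=
  h.monotone_map.continuous_of_surjective fun x => ⟨R x, h.right_inv x⟩

end BiLipschitzPair

/-- The primitive of the inverse map `R`, a convex Kantorovich potential. -/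
noncomputable def targetPotential (R : ℝ → ℝ) (y : ℝ) : ℝ := ∫ s in (0 : ℝ)..y, R s

/-- The convex conjugate of `targetPotential R`, when `T` is the inverse of `R`. -/
noncomputable def sourcePotential (T R : ℝ → ℝ) (x : ℝ) : ℝ := x * T x - targetPotential R (T x)

/-- The duality gap of the Kantorovich potentials. -/
noncomputable def gap (T R : ℝ → ℝ) (x y : ℝ) : ℝ :=
  sourcePotential T R x + targetPotential R y - x * y

namespace BiLipschitzPair

variable {T R : ℝ → ℝ} {m M : ℝ}

theorem continuous_targetPotential (h : BiLipschitzPair T R m M) :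
    Continuous (targetPotential R) :=
  continuous_iff_continuousAt.2 fun x =>
    (h.continuous_inv.integral_hasStrictDerivAt 0 x).hasDerivAt.continuousAt

theorem continuous_sourcePotential (h : BiLipschitzPair T R m M) :
    Continuous (sourcePotential T R) := by
  have := h.continuous_map
  have := h.continuous_targetPotential
  unfold sourcePotential
  fun_prop

theorem continuous_gap (h : BiLipschitzPair T R m M) :
    Continuous fun z : ℝ × ℝ => gap T R z.1 z.2 := by
  have := h.continuous_sourcePotential
  have := h.continuous_targetPotential
  unfold gap
  fun_prop

/-- This is the area picture of Young's inequality. The integrand vanishes at `s = T x`, so linear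
bounds on `R s - x` integrate to quadratic bounds on the gap. -/
theorem gap_eq_integral (h : BiLipschitzPair T R m M) (x y : ℝ) :
    gap T R x y = ∫ s in T x..y, (R s - x) := by
  have hi := fun c d => h.continuous_inv.intervalIntegrable (μ := volume) c d
  rw [intervalIntegral.integral_sub (hi _ _) (by simp), intervalIntegral.integral_const, gap,
    sourcePotential, targetPotential, targetPotential,
    ← intervalIntegral.integral_interval_sub_left (hi 0 y) (hi 0 (T x))]
  simp only [smul_eq_mul]; ring

theorem integral_linear (c k y : ℝ) : ∫ s in c..y, k * (s - c) = k / 2 * (y - c) ^ 2 := by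
  rw [intervalIntegral.integral_const_mul,
    intervalIntegral.integral_comp_sub_right (fun s => s), integral_id]
  ring

theorem gap_bounds (h : BiLipschitzPair T R m M) (x y : ℝ) :
    m / 2 * (y - T x) ^ 2 ≤ gap T R x y ∧ gap T R x y ≤ M / 2 * (y - T x) ^ 2 := by
  have hR : Continuous fun s => R s - x := by have := h.continuous_inv; fun_prop
  have hL : ∀ k : ℝ, Continuous fun s => k * (s - T x) := fun k => by fun_prop
  have hi := fun c d => hR.intervalIntegrable (μ := volume) c d
  have hl := fun k c d => (hL k).intervalIntegrable (μ := volume) c d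
  have hx := h.left_inv x
  rw [h.gap_eq_integral, ← integral_linear, ← integral_linear]
  rcases le_total (T x) y with hy | hy
  · constructor <;> refine intervalIntegral.integral_mono_on hy (by simp [hi, hl])
      (by simp [hi, hl]) fun s hs => ?_
    · linarith [h.lower _ _ hs.1]
    · linarith [h.upper _ _ hs.1]
  · simp only [intervalIntegral.integral_symm y (T x), neg_le_neg_iff]
    constructor <;> refine intervalIntegral.integral_mono_on hy (by simp [hi, hl])
      (by simp [hi, hl]) fun s hs => ?_
    · linarith [h.lower _ _ hs.2]
    · linarith [h.upper _ _ hs.2]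

end BiLipschitzPair

/-! ### The monotone rearrangement and its identification with the Monge map. -/

variable {μ₀ μ₁ : Measure ℝ} {a₀ b₀ a₁ b₁ : ℝ} {u₀ u₁ : ℝ → ℝ} {lo₀ hi₀ lo₁ hi₁ : ℝ}

/-- `T` is the inverse of the second distribution function composed with the first. Comparing
increments of the two functions bounds the slopes of `R` by ratios of the density bounds. -/
theorem exists_monotone_rearrangement (h₀ : RegularDensity μ₀ a₀ b₀ u₀ lo₀ hi₀)
    (h₁ : RegularDensity μ₁ a₁ b₁ u₁ lo₁ hi₁) :
    ∃ T R, BiLipschitzPair T R (lo₁ / hi₀) (hi₁ / lo₀) ∧ ∀ x, h₁.cdf (T x) = h₀.cdf x := by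
  choose T hT using fun x => h₁.surjective_cdf (h₀.cdf x)
  choose R hR using fun y => h₀.surjective_cdf (h₁.cdf y)
  have hRmono : Monotone R := fun y z hyz => by
    rw [← h₀.strictMono_cdf.le_iff_le, hR, hR]
    exact h₁.strictMono_cdf.monotone hyz
  refine ⟨T, R, ⟨div_pos h₁.lo_pos h₀.hi_pos, fun x => ?_, fun y => ?_, fun y z hyz => ?_,
    fun y z hyz => ?_⟩, hT⟩
  · exact h₀.strictMono_cdf.injective (by rw [hR, hT])
  · exact h₁.strictMono_cdf.injective (by rw [hT, hR])
  · have h1 := h₁.mul_le_cdf_sub hyz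
    have h2 := h₀.cdf_sub_le_mul (hRmono hyz)
    rw [hR, hR] at h2
    rw [div_mul_eq_mul_div, div_le_iff₀ h₀.hi_pos]
    linarith
  · have h1 := h₁.cdf_sub_le_mul hyz
    have h2 := h₀.mul_le_cdf_sub (hRmono hyz)
    rw [hR, hR] at h2
    rw [div_mul_eq_mul_div, le_div_iff₀ h₀.lo_pos]
    linarith

/-- Each distribution function pushes its own measure to the uniform law on `[0, 1]`, and the one of
`μ₁` is an embedding, so it can be cancelled. -/
theorem map_rearrangement [IsProbabilityMeasure μ₀] [IsProbabilityMeasure μ₁]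
    (h₀ : RegularDensity μ₀ a₀ b₀ u₀ lo₀ hi₀) (h₁ : RegularDensity μ₁ a₁ b₁ u₁ lo₁ hi₁)
    {T : ℝ → ℝ} (hTm : Measurable T) (hT : ∀ x, h₁.cdf (T x) = h₀.cdf x) : μ₀.map T = μ₁ := by
  have hemb : MeasurableEmbedding h₁.cdf :=
    h₁.continuous_cdf.measurableEmbedding h₁.strictMono_cdf.injective
  have hmap : (μ₀.map T).map h₁.cdf = μ₁.map h₁.cdf := by
    rw [Measure.map_map h₁.continuous_cdf.measurable hTm, h₁.map_cdf, ← h₀.map_cdf]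
    congr 1
    exact funext hT
  rw [← hemb.comap_map (μ₀.map T), hmap, hemb.comap_map]

/-- The cost of a transport map between compactly supported measures. -/
theorem transportCost_map_eq [IsProbabilityMeasure μ₀] [IsProbabilityMeasure μ₁]
    (h₀ : RegularDensity μ₀ a₀ b₀ u₀ lo₀ hi₀) (h₁ : RegularDensity μ₁ a₁ b₁ u₁ lo₁ hi₁)
    {S : ℝ → ℝ} (hS : Measurable S) (hmap : μ₀.map S = μ₁) :
    Integrable (fun x => x * S x) μ₀ ∧
    0 ≤ (∫ x, x ^ 2 / 2 ∂μ₀) + (∫ y, y ^ 2 / 2 ∂μ₁) - ∫ x, x * S x ∂μ₀ ∧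
    transportCost (μ₀.map fun x => (x, S x)) =
      ENNReal.ofReal ((∫ x, x ^ 2 / 2 ∂μ₀) + (∫ y, y ^ 2 / 2 ∂μ₁) - ∫ x, x * S x ∂μ₀) := by
  have hSi : Integrable (fun x => S x ^ 2 / 2) μ₀ := by
    have := h₁.integrable (φ := fun y => y ^ 2 / 2) (by fun_prop)
    rw [← hmap] at this
    exact this.comp_measurable hS
  have hxi : Integrable (fun x => x ^ 2 / 2) μ₀ := h₀.integrable (by fun_prop)
  have hxS : Integrable (fun x => x * S x) μ₀ := by
    refine (hxi.add hSi).mono' (by fun_prop) (.of_forall fun x => ?_)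
    rw [Real.norm_eq_abs, abs_le, Pi.add_apply]
    constructor <;> nlinarith [sq_nonneg (x + S x), sq_nonneg (x - S x)]
  refine ⟨hxS, ?_⟩
  have hci : Integrable (fun x => (x - S x) ^ 2 / 2) μ₀ := by
    refine ((hxi.add hSi).sub hxS).congr (.of_forall fun x => ?_)
    simp only [Pi.add_apply, Pi.sub_apply]; ring
  have h2 : ∫ x, S x ^ 2 / 2 ∂μ₀ = ∫ y, y ^ 2 / 2 ∂μ₁ := by
    rw [← hmap, integral_map hS.aemeasurable (by fun_prop)]
  have hadd : Integrable (fun x => x ^ 2 / 2 + S x ^ 2 / 2) μ₀ := hxi.add hSi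
  have hval : (∫ x, x ^ 2 / 2 ∂μ₀) + (∫ y, y ^ 2 / 2 ∂μ₁) - ∫ x, x * S x ∂μ₀ =
      ∫ x, (x - S x) ^ 2 / 2 ∂μ₀ := by
    rw [← h2, ← integral_add hxi hSi, ← integral_sub hadd hxS]
    refine integral_congr_ae (.of_forall fun x => ?_)
    simp only; ring
  rw [hval]
  refine ⟨integral_nonneg fun x => by positivity, ?_⟩
  rw [transportCost, lintegral_map (by fun_prop) (by fun_prop),
    ← ofReal_integral_eq_lintegral_ofReal hci (.of_forall fun x => by positivity)]

/-- The integral of the gap along a transport map is its excess cost over `T`. Optimality makes this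
zero for `T₀`, and the gap vanishes only on the graph of `T`. -/
theorem isMongeMap_ae_eq [IsProbabilityMeasure μ₀] [IsProbabilityMeasure μ₁]
    (h₀ : RegularDensity μ₀ a₀ b₀ u₀ lo₀ hi₀) (h₁ : RegularDensity μ₁ a₁ b₁ u₁ lo₁ hi₁)
    {T R : ℝ → ℝ} {m M : ℝ} (hTR : BiLipschitzPair T R m M)
    (hT : ∀ x, h₁.cdf (T x) = h₀.cdf x) {T₀ : ℝ → ℝ} (hT₀ : IsMongeMap μ₀ μ₁ T₀) :
    T₀ =ᵐ[μ₀] T := by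
  obtain ⟨hm, hc, hopt⟩ := hT₀
  have hTc := hTR.continuous_map
  have hmapT := map_rearrangement h₀ h₁ hTc.measurable hT
  have hmap : μ₀.map T₀ = μ₁ := by
    rw [← hc.2, Measure.map_map measurable_snd (by fun_prop)]; rfl
  have hle := hopt (μ₀.map fun x => (x, T x)) ⟨by
    rw [Measure.map_map measurable_fst (by fun_prop)]; exact Measure.map_id, by
    rw [Measure.map_map measurable_snd (by fun_prop)]; exact hmapT⟩
  obtain ⟨hi, -, he⟩ := transportCost_map_eq h₀ h₁ hm hmap
  obtain ⟨hi', hcost, he'⟩ := transportCost_map_eq h₀ h₁ hTc.measurable hmapT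
  have hgc := hTR.continuous_targetPotential
  have hgi : ∀ S : ℝ → ℝ, Measurable S → μ₀.map S = μ₁ →
      Integrable (fun x => targetPotential R (S x)) μ₀ := fun S hS hmS => by
    have := h₁.integrable hgc
    rw [← hmS] at this
    exact this.comp_measurable hS
  have hge : ∀ S : ℝ → ℝ, Measurable S → μ₀.map S = μ₁ →
      ∫ x, targetPotential R (S x) ∂μ₀ = ∫ y, targetPotential R y ∂μ₁ := fun S hS hmS => by
    rw [← hmS, integral_map hS.aemeasurable hgc.aestronglyMeasurable]
  have hsi := h₀.integrable hTR.continuous_sourcePotential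
  have hsT : ∫ x, sourcePotential T R x ∂μ₀ =
      (∫ x, x * T x ∂μ₀) - ∫ y, targetPotential R y ∂μ₁ := by
    rw [← hge T hTc.measurable hmapT, ← integral_sub hi' (hgi T hTc.measurable hmapT)]
    rfl
  have hgapi : Integrable (fun x => gap T R x (T₀ x)) μ₀ := (hsi.add (hgi T₀ hm hmap)).sub hi
  have hgap : ∫ x, gap T R x (T₀ x) ∂μ₀ = (∫ x, x * T x ∂μ₀) - ∫ x, x * T₀ x ∂μ₀ := by
    have hadd : Integrable (fun x => sourcePotential T R x + targetPotential R (T₀ x)) μ₀ :=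
      hsi.add (hgi T₀ hm hmap)
    unfold gap
    rw [integral_sub hadd hi, integral_add hsi (hgi T₀ hm hmap), hsT,
      hge T₀ hm hmap]
    ring
  have hnn : 0 ≤ fun x => gap T R x (T₀ x) := fun x => by
    have := (hTR.gap_bounds x (T₀ x)).1
    exact le_trans (mul_nonneg (by linarith [hTR.m_pos]) (sq_nonneg _)) this
  have hz : ∫ x, gap T R x (T₀ x) ∂μ₀ = 0 := by
    refine le_antisymm ?_ (integral_nonneg hnn)
    rw [he, he', ENNReal.ofReal_le_ofReal_iff hcost] at hle
    linarith
  filter_upwards [(integral_eq_zero_iff_of_nonneg hnn hgapi).1 hz] with x hx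
  have h1 := (hTR.gap_bounds x (T₀ x)).1
  rw [show gap T R x (T₀ x) = 0 from hx] at h1
  have h2 : (T₀ x - T x) ^ 2 ≤ 0 := by
    by_contra! hlt
    nlinarith [mul_pos hTR.m_pos hlt]
  nlinarith [pow_eq_zero_iff (two_ne_zero) |>.1 (le_antisymm h2 (sq_nonneg _))]

/-! ### The dual problem and its first-order condition. -/

theorem dualObjective_congr [SFinite μ₀] [SFinite μ₁] (ε : ℝ) {φ φ' ψ ψ' : ℝ → ℝ}
    (hφ : φ =ᵐ[μ₀] φ') (hψ : ψ =ᵐ[μ₁] ψ') :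
    dualObjective μ₀ μ₁ ε φ ψ = dualObjective μ₀ μ₁ ε φ' ψ' := by
  unfold dualObjective
  rw [integral_congr_ae hφ, integral_congr_ae hψ]
  congr 2
  refine integral_congr_ae ?_
  filter_upwards [Measure.quasiMeasurePreserving_fst.ae hφ,
    Measure.quasiMeasurePreserving_snd.ae hψ] with z h1 h2
  rw [h1, h2]

theorem IsDualSolution.congr [SFinite μ₀] [SFinite μ₁] {ε : ℝ} {φ φ' ψ ψ' : ℝ → ℝ}
    (h : IsDualSolution μ₀ μ₁ ε φ ψ) (hφ : φ =ᵐ[μ₀] φ') (hψ : ψ =ᵐ[μ₁] ψ') :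
    IsDualSolution μ₀ μ₁ ε φ' ψ' := by
  refine ⟨(memLp_congr_ae hφ).1 h.1, (memLp_congr_ae hψ).1 h.2.1, ?_⟩
  rw [← dualObjective_congr ε hφ hψ]
  exact h.2.2

theorem dualObjective_swap [SFinite μ₀] [SFinite μ₁] (ε : ℝ) (φ ψ : ℝ → ℝ) :
    dualObjective μ₁ μ₀ ε ψ φ = dualObjective μ₀ μ₁ ε φ ψ := by
  unfold dualObjective
  rw [← integral_prod_swap, add_comm (∫ x, φ x ∂μ₀)]
  simp only [Prod.fst_swap, Prod.snd_swap]
  congr 3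
  ext z
  congr 2
  ring

theorem IsDualSolution.swap [SFinite μ₀] [SFinite μ₁] {ε : ℝ} {φ ψ : ℝ → ℝ}
    (h : IsDualSolution μ₀ μ₁ ε φ ψ) : IsDualSolution μ₁ μ₀ ε ψ φ := by
  refine ⟨h.2.1, h.1, fun φ' ψ' hφ hψ => ?_⟩
  rw [dualObjective_swap ε ψ' φ', dualObjective_swap ε φ ψ]
  exact h.2.2 _ _ hψ hφ

theorem sq_max_add_le (s t : ℝ) : (max (s + t) 0) ^ 2 ≤ (max s 0) ^ 2 + 2 * (t * max s 0) + t ^ 2 := by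
  have h : 0 ≤ max s 0 := le_max_right _ _
  have h' : s ≤ max s 0 := le_max_left _ _
  rcases le_total (s + t) 0 with hst | hst
  · rw [max_eq_right hst]; nlinarith [sq_nonneg (max s 0 + t)]
  · rw [max_eq_left hst]; nlinarith

/-- The first-order condition: the positive part of `x y - f(x) - g(y)` is, up to the factor `ε`,
the density of a coupling. -/
theorem IsDualSolution.integral_eq [IsProbabilityMeasure μ₀] [IsProbabilityMeasure μ₁]
    (h₀ : RegularDensity μ₀ a₀ b₀ u₀ lo₀ hi₀) (h₁ : RegularDensity μ₁ a₁ b₁ u₁ lo₁ hi₁)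
    {ε : ℝ} (hε : 0 < ε) {f g : ℝ → ℝ} (hf : Continuous f) (hg : Continuous g)
    (h : IsDualSolution μ₀ μ₁ ε (fun x => x ^ 2 / 2 - f x) (fun y => y ^ 2 / 2 - g y)) :
    ∀ x ∈ Icc a₀ b₀, ∫ y, max (x * y - f x - g y) 0 ∂μ₁ = ε := by
  -- `η / ε` is the gradient of the objective in `φ`. Moving `φ` by `η` raises the objective by at
  -- least `(1 / (2ε)) ∫ η²`, so optimality forces `η = 0` a.e., and continuity then gives it on the
  -- whole interval.
  set η : ℝ → ℝ := fun x => ε - ∫ y, max (x * y - f x - g y) 0 ∂μ₁ with hη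
  have hηc : Continuous η := by
    refine continuous_const.sub (h₁.continuous_integral ?_)
    simp only [Function.uncurry_def]
    fun_prop
  have hopt := h.2.2 (fun x => x ^ 2 / 2 - f x + η x) (fun y => y ^ 2 / 2 - g y)
    (h₀.memLp (by fun_prop)) (h₁.memLp (by fun_prop))
  unfold dualObjective at hopt
  rw [integral_add (h₀.integrable (by fun_prop)) (h₀.integrable hηc)] at hopt
  have hP : Integrable (fun z : ℝ × ℝ => (max (z.1 * z.2 - f z.1 - g z.2) 0) ^ 2) (μ₀.prod μ₁) :=
    h₀.integrable_prod h₁ (by fun_prop)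
  have hηP : Integrable (fun z : ℝ × ℝ => 2 * (η z.1 * max (z.1 * z.2 - f z.1 - g z.2) 0))
      (μ₀.prod μ₁) := h₀.integrable_prod h₁ (by fun_prop)
  have hηη : Integrable (fun z : ℝ × ℝ => η z.1 ^ 2) (μ₀.prod μ₁) :=
    h₀.integrable_prod h₁ (by fun_prop)
  have hcross : ∫ z, 2 * (η z.1 * max (z.1 * z.2 - f z.1 - g z.2) 0) ∂(μ₀.prod μ₁) =
      2 * (ε * ∫ x, η x ∂μ₀ - ∫ x, η x ^ 2 ∂μ₀) := by
    rw [integral_const_mul, integral_prod _ (h₀.integrable_prod h₁ (by fun_prop)),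
      ← integral_const_mul ε, ← integral_sub (h₀.integrable (by fun_prop))
        (h₀.integrable (by fun_prop))]
    congr 1
    refine integral_congr_ae (.of_forall fun x => ?_)
    simp only
    rw [integral_const_mul, hη]; ring
  have hsq : ∫ z : ℝ × ℝ, η z.1 ^ 2 ∂(μ₀.prod μ₁) = ∫ x, η x ^ 2 ∂μ₀ := by
    simpa using integral_prod_mul (μ := μ₀) (ν := μ₁) (fun x => η x ^ 2) (fun _ => (1 : ℝ))
  have hle : ∫ z : ℝ × ℝ, (max (z.1 ^ 2 / 2 - f z.1 + η z.1 + (z.2 ^ 2 / 2 - g z.2)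
        - (z.1 - z.2) ^ 2 / 2) 0) ^ 2 ∂(μ₀.prod μ₁) ≤
      ∫ z : ℝ × ℝ, ((max (z.1 * z.2 - f z.1 - g z.2) 0) ^ 2 +
        2 * (η z.1 * max (z.1 * z.2 - f z.1 - g z.2) 0) + η z.1 ^ 2) ∂(μ₀.prod μ₁) := by
    refine integral_mono (h₀.integrable_prod h₁ (by fun_prop))
      (h₀.integrable_prod h₁ (by fun_prop)) fun z => ?_
    have := sq_max_add_le (z.1 * z.2 - f z.1 - g z.2) (η z.1)
    rwa [show z.1 * z.2 - f z.1 - g z.2 + η z.1 = z.1 ^ 2 / 2 - f z.1 + η z.1 +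
      (z.2 ^ 2 / 2 - g z.2) - (z.1 - z.2) ^ 2 / 2 by ring] at this
  rw [integral_add (h₀.integrable_prod h₁ (by fun_prop)) hηη, integral_add hP hηP, hcross,
    hsq] at hle
  have hsame : ∫ z : ℝ × ℝ, (max (z.1 ^ 2 / 2 - f z.1 + (z.2 ^ 2 / 2 - g z.2)
        - (z.1 - z.2) ^ 2 / 2) 0) ^ 2 ∂(μ₀.prod μ₁) =
      ∫ z : ℝ × ℝ, (max (z.1 * z.2 - f z.1 - g z.2) 0) ^ 2 ∂(μ₀.prod μ₁) := by
    congr 1; ext z; congr 2; ring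
  rw [hsame] at hopt
  have hinv : 1 / (2 * ε) * (2 * ε) = 1 := by field_simp
  have hpos : 0 < 1 / (2 * ε) := by positivity
  have hzero : ∫ x, η x ^ 2 ∂μ₀ = 0 := by
    refine le_antisymm ?_ (integral_nonneg fun x => sq_nonneg _)
    have h3 := mul_le_mul_of_nonneg_left hle hpos.le
    have h4 : 1 / (2 * ε) * (2 * (ε * ∫ x, η x ∂μ₀)) = ∫ x, η x ∂μ₀ := by field_simp
    by_contra! hlt
    nlinarith [mul_pos hpos hlt]
  have hae := (integral_eq_zero_iff_of_nonneg (fun x => sq_nonneg (η x))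
    (h₀.integrable (by fun_prop))).1 hzero
  intro x hx
  have := h₀.eqOn_of_ae_eq (hηc.pow 2) continuous_const hae hx
  simp only [hη] at this
  have := pow_eq_zero_iff (two_ne_zero) |>.1 this
  linarith

/-! ### Sections, barycenters and differentiability of the potentials. -/

/-- The average of `y` over the set where `x y - f(x) - g(y)` is positive. -/
noncomputable def barycenter (μ₁ : Measure ℝ) (f g : ℝ → ℝ) (x : ℝ) : ℝ :=
  (∫ y in {y | 0 < x * y - f x - g y}, y ∂μ₁) / μ₁.real {y | 0 < x * y - f x - g y}

section

variable {ε : ℝ} {f g : ℝ → ℝ}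

theorem measurableSet_pos (hg : Continuous g) (x : ℝ) :
    MeasurableSet {y | 0 < x * y - f x - g y} :=
  (isOpen_lt continuous_const (by fun_prop)).measurableSet

theorem measureReal_pos (hε : 0 < ε) [IsFiniteMeasure μ₁] {x : ℝ}
    (hx : ∫ y, max (x * y - f x - g y) 0 ∂μ₁ = ε) :
    0 < μ₁.real {y | 0 < x * y - f x - g y} := by
  refine lt_of_le_of_ne measureReal_nonneg fun h0 => hε.ne' ?_
  rw [← hx]
  refine integral_eq_zero_of_ae ?_
  have h1 : μ₁ {y | 0 < x * y - f x - g y} = 0 := by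
    rwa [eq_comm, measureReal_eq_zero_iff] at h0
  filter_upwards [measure_eq_zero_iff_ae_notMem.1 h1] with y hy
  exact max_eq_right (not_lt.1 hy)

theorem exists_pos (hε : 0 < ε) [IsFiniteMeasure μ₁]
    (h₁ : RegularDensity μ₁ a₁ b₁ u₁ lo₁ hi₁) {x : ℝ}
    (hx : ∫ y, max (x * y - f x - g y) 0 ∂μ₁ = ε) :
    ∃ y ∈ Icc a₁ b₁, 0 < x * y - f x - g y := by
  by_contra! hcon
  have h0 : μ₁ {y | 0 < x * y - f x - g y} = 0 := by
    refine measure_eq_zero_iff_ae_notMem.2 ?_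
    filter_upwards [h₁.ae_mem] with y hy
    exact not_lt.2 (hcon y hy)
  have := measureReal_pos hε hx
  rw [measureReal_def, h0] at this
  exact lt_irrefl _ this

/-- The barycenter of the section is a subgradient of the potential. -/
theorem barycenter_mul_le [IsFiniteMeasure μ₁] (h₁ : RegularDensity μ₁ a₁ b₁ u₁ lo₁ hi₁)
    (hε : 0 < ε) (hg : Continuous g) {x x' : ℝ}
    (hx : ∫ y, max (x * y - f x - g y) 0 ∂μ₁ = ε)
    (hx' : ∫ y, max (x' * y - f x' - g y) 0 ∂μ₁ = ε) :
    barycenter μ₁ f g x * (x' - x) ≤ f x' - f x := by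
  have hA := measurableSet_pos (f := f) hg x
  have hpos := measureReal_pos hε hx
  set A := {y | 0 < x * y - f x - g y} with hAdef
  have hi1 : Integrable (fun y => max (x' * y - f x' - g y) 0) μ₁ := h₁.integrable (by fun_prop)
  have hi2 : Integrable (fun y => max (x * y - f x - g y) 0) μ₁ := h₁.integrable (by fun_prop)
  have hi3 : Integrable (fun y => (x' - x) * y) μ₁ := h₁.integrable (by fun_prop)
  have hi4 : Integrable (fun y => (x' - x) * y - (f x' - f x)) μ₁ := h₁.integrable (by fun_prop)
  -- Convexity of the positive part: its slope at the section function of `x` is the indicator of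
  -- `A`. The right side integrates to `ε - ε = 0`.
  have hle : ∫ y in A, ((x' - x) * y - (f x' - f x)) ∂μ₁ ≤
      ∫ y, (max (x' * y - f x' - g y) 0 - max (x * y - f x - g y) 0) ∂μ₁ := by
    rw [← integral_indicator hA]
    refine integral_mono (hi4.indicator hA) (hi1.sub hi2) fun y => ?_
    by_cases hy : y ∈ A
    · simp only [indicator_of_mem hy]
      rw [max_eq_left (a := x * y - f x - g y) (le_of_lt hy)]
      linarith [le_max_left (x' * y - f x' - g y) 0]
    · simp only [indicator_of_notMem hy]
      rw [max_eq_right (a := x * y - f x - g y) (not_lt.1 hy)]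
      linarith [le_max_right (x' * y - f x' - g y) 0]
  rw [integral_sub hi1 hi2, hx, hx', integral_sub hi3.integrableOn (by simp),
    integral_const_mul, setIntegral_const, smul_eq_mul] at hle
  rw [barycenter, ← hAdef, div_mul_eq_mul_div, div_le_iff₀ hpos]
  linarith

theorem convexOn_of_subgradient {s : Set ℝ} (hs : Convex ℝ s) {φ n : ℝ → ℝ}
    (h : ∀ x ∈ s, ∀ x' ∈ s, n x * (x' - x) ≤ φ x' - φ x) : ConvexOn ℝ s φ := by
  refine ⟨hs, fun x hx y hy α β hα hβ hαβ => ?_⟩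
  have hz := hs hx hy hα hβ hαβ
  have h1 := mul_le_mul_of_nonneg_left (h _ hz _ hx) hα
  have h2 := mul_le_mul_of_nonneg_left (h _ hz _ hy) hβ
  simp only [smul_eq_mul] at *
  have hβ' : β = 1 - α := by linarith
  subst hβ'
  nlinarith

theorem concaveOn_section {s : Set ℝ} (hg : ConvexOn ℝ s g) (x : ℝ) :
    ConcaveOn ℝ s fun y => x * y - f x - g y := by
  refine ⟨hg.1, fun y hy z hz α β hα hβ hαβ => ?_⟩
  have := hg.2 hy hz hα hβ hαβ
  simp only [smul_eq_mul] at *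
  have hβ' : β = 1 - α := by linarith
  subst hβ'
  linarith

/-- Strictly between a zero and a point `w` of positivity, concavity gives positive values. So there
is at most one zero on each side of `w`. -/
theorem finite_zeros_of_concaveOn {s : Set ℝ} {φ : ℝ → ℝ} (h : ConcaveOn ℝ s φ)
    (hpos : ∃ y ∈ s, 0 < φ y) : {y ∈ s | φ y = 0}.Finite := by
  obtain ⟨w, hw, hφw⟩ := hpos
  have key : ∀ y ∈ s, ∀ z, φ y = 0 → (∃ α β : ℝ, 0 ≤ α ∧ 0 < β ∧ α + β = 1 ∧ z = α * y + β * w) →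
      0 < φ z := by
    rintro y hy z hφy ⟨α, β, hα, hβ, hαβ, rfl⟩
    have := h.2 hy hw hα hβ.le hαβ
    simp only [smul_eq_mul, hφy] at this
    nlinarith [mul_pos hβ hφw]
  have hcomb : ∀ y z : ℝ, y ≠ w → 0 ≤ (w - z) / (w - y) → 0 < (z - y) / (w - y) →
      ∃ α β : ℝ, 0 ≤ α ∧ 0 < β ∧ α + β = 1 ∧ z = α * y + β * w := fun y z hne h1 h2 => by
    have : w - y ≠ 0 := sub_ne_zero.2 hne.symm
    exact ⟨_, _, h1, h2, by field_simp; ring, by field_simp; ring⟩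
  have hL : ({y ∈ s | φ y = 0} ∩ Iio w).Subsingleton := by
    have : ∀ y ∈ {y ∈ s | φ y = 0} ∩ Iio w, ∀ z ∈ {y ∈ s | φ y = 0} ∩ Iio w, ¬ y < z := by
      rintro y ⟨⟨hy, hy0⟩, hyw⟩ z ⟨⟨hz, hz0⟩, hzw⟩ hyz
      have h1 : 0 < w - y := sub_pos.2 hyw
      have h2 : 0 < w - z := sub_pos.2 hzw
      have h3 : 0 < z - y := sub_pos.2 hyz
      exact (key y hy z hy0 (hcomb y z (ne_of_lt hyw) (by positivity) (by positivity))).ne' hz0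
    exact fun y hy z hz => le_antisymm (not_lt.1 (this z hz y hy)) (not_lt.1 (this y hy z hz))
  have hR : ({y ∈ s | φ y = 0} ∩ Ioi w).Subsingleton := by
    have : ∀ y ∈ {y ∈ s | φ y = 0} ∩ Ioi w, ∀ z ∈ {y ∈ s | φ y = 0} ∩ Ioi w, ¬ z < y := by
      rintro y ⟨⟨hy, hy0⟩, hyw⟩ z ⟨⟨hz, hz0⟩, hzw⟩ hyz
      have h1 : w - y < 0 := sub_neg.2 hyw
      have h2 : w - z < 0 := sub_neg.2 hzw
      have h3 : z - y < 0 := sub_neg.2 hyz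
      exact (key y hy z hy0 (hcomb y z (ne_of_gt hyw) (div_nonneg_of_nonpos h2.le h1.le)
        (div_pos_of_neg_of_neg h3 h1))).ne' hz0
    exact fun y hy z hz => le_antisymm (not_lt.1 (this y hy z hz)) (not_lt.1 (this z hz y hy))
  refine (hL.finite.union hR.finite).subset fun y hy => ?_
  rcases lt_trichotomy y w with hlt | rfl | hlt
  · exact .inl ⟨hy, hlt⟩
  · exact absurd hy.2 hφw.ne'
  · exact .inr ⟨hy, hlt⟩

/-- The indicator of the positivity set is locally constant in `x` away from the zeros of the
section function. These are finite in number, hence null, and dominated convergence applies. -/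
theorem continuousAt_setIntegral_pos [IsFiniteMeasure μ₁]
    (h₁ : RegularDensity μ₁ a₁ b₁ u₁ lo₁ hi₁) (hf : Continuous f) (hg : Continuous g)
    {w : ℝ → ℝ} (hw : Continuous w) {x : ℝ}
    (hx : {y ∈ Icc a₁ b₁ | x * y - f x - g y = 0}.Finite) :
    ContinuousAt (fun x => ∫ y in {y | 0 < x * y - f x - g y}, w y ∂μ₁) x := by
  simp only [← integral_indicator (measurableSet_pos (f := f) hg _)]
  refine continuousAt_of_dominated (bound := fun y => |w y|) ?_ ?_ (h₁.integrable hw.abs) ?_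
  · exact .of_forall fun x => hw.aestronglyMeasurable.indicator (measurableSet_pos hg x)
  · refine .of_forall fun x => .of_forall fun y => ?_
    exact norm_indicator_le_norm_self _ _
  · filter_upwards [h₁.ae_mem, measure_eq_zero_iff_ae_notMem.1 (h₁.finite_eq_zero hx)]
      with y hy hy0
    have hne : x * y - f x - g y ≠ 0 := fun h0 => hy0 ⟨hy, h0⟩
    have hc : ContinuousAt (fun x => x * y - f x - g y) x := by fun_prop
    rcases hne.lt_or_gt with hlt | hgt
    · refine (continuousAt_const (y := (0 : ℝ))).congr ?_
      filter_upwards [hc.eventually_lt continuousAt_const hlt] with x' hx'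
      rw [indicator_of_notMem]
      exact not_lt.2 hx'.le
    · refine (continuousAt_const (y := w y)).congr ?_
      filter_upwards [continuousAt_const.eventually_lt hc hgt] with x' hx'
      rw [indicator_of_mem]
      exact hx'

/-- The subgradient inequalities at `x` and at `x'` trap the increment between `n x * (x' - x)` and
`n x' * (x' - x)`. -/
theorem hasDerivWithinAt_of_subgradient {s : Set ℝ} {φ n : ℝ → ℝ}
    (h : ∀ x ∈ s, ∀ x' ∈ s, n x * (x' - x) ≤ φ x' - φ x) {x : ℝ} (hx : x ∈ s)
    (hn : ContinuousWithinAt n s x) : HasDerivWithinAt φ (n x) s x := by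
  rw [hasDerivWithinAt_iff_isLittleO, Asymptotics.isLittleO_iff]
  intro c hc
  filter_upwards [Metric.continuousWithinAt_iff'.1 hn c hc, self_mem_nhdsWithin] with x' hd hx'
  rw [Real.dist_eq] at hd
  have h1 := h x hx x' hx'
  have h2 := h x' hx' x hx
  rw [Real.norm_eq_abs, Real.norm_eq_abs, smul_eq_mul]
  have h3 : |φ x' - φ x - (x' - x) * n x| ≤ |(n x' - n x) * (x' - x)| := by
    rw [abs_of_nonneg (by linarith)]
    exact le_trans (by linarith) (le_abs_self _)
  rw [abs_mul] at h3
  exact h3.trans (mul_le_mul_of_nonneg_right hd.le (abs_nonneg _))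

end

/-- The properties of continuous potentials used in the estimates. -/
structure RegularPotentials (μ₀ μ₁ : Measure ℝ) (Ω₀ Ω₁ : Set ℝ) (ε : ℝ) (f g : ℝ → ℝ) : Prop where
  continuous_left : Continuous f
  continuous_right : Continuous g
  integral_right : ∀ x ∈ Ω₀, ∫ y, max (x * y - f x - g y) 0 ∂μ₁ = ε
  integral_left : ∀ y ∈ Ω₁, ∫ x, max (x * y - f x - g y) 0 ∂μ₀ = ε
  convexOn_right : ConvexOn ℝ Ω₁ g
  continuousOn_barycenter : ContinuousOn (barycenter μ₁ f g) Ω₀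
  hasDerivWithinAt : ∀ x ∈ Ω₀, HasDerivWithinAt f (barycenter μ₁ f g x) Ω₀ x

theorem IsDualSolution.regularPotentials [IsProbabilityMeasure μ₀] [IsProbabilityMeasure μ₁]
    (h₀ : RegularDensity μ₀ a₀ b₀ u₀ lo₀ hi₀) (h₁ : RegularDensity μ₁ a₁ b₁ u₁ lo₁ hi₁)
    {ε : ℝ} (hε : 0 < ε) {f g : ℝ → ℝ} (hf : Continuous f) (hg : Continuous g)
    (h : IsDualSolution μ₀ μ₁ ε (fun x => x ^ 2 / 2 - f x) (fun y => y ^ 2 / 2 - g y)) :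
    RegularPotentials μ₀ μ₁ (Icc a₀ b₀) (Icc a₁ b₁) ε f g := by
  have hr := h.integral_eq h₀ h₁ hε hf hg
  have hl := h.swap.integral_eq h₁ h₀ hε hg hf
  have hconv : ConvexOn ℝ (Icc a₁ b₁) g :=
    convexOn_of_subgradient (convex_Icc _ _) fun y hy y' hy' =>
      barycenter_mul_le (f := g) h₀ hε hf (hl y hy) (hl y' hy')
  have hbc : ContinuousOn (barycenter μ₁ f g) (Icc a₀ b₀) := fun x hx => by
    have hfin := finite_zeros_of_concaveOn (concaveOn_section (f := f) hconv x)
      (exists_pos hε h₁ (hr x hx))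
    have h1 := continuousAt_setIntegral_pos h₁ hf hg continuous_id hfin
    have h2 := continuousAt_setIntegral_pos h₁ hf hg (continuous_const (y := (1 : ℝ))) hfin
    simp only [setIntegral_const, smul_eq_mul, mul_one] at h2
    exact (h1.div h2 (measureReal_pos hε (hr x hx)).ne').continuousWithinAt
  refine ⟨hf, hg, hr, fun y hy => ?_, hconv, hbc, fun x hx =>
    hasDerivWithinAt_of_subgradient (fun x hx x' hx' =>
      barycenter_mul_le (f := f) h₁ hε hg (hr x hx) (hr x' hx')) hx (hbc x hx)⟩
  rw [← hl y hy]
  congr 1; ext x; congr 1; ring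

/-! ### Second moments of concave bumps. -/

/-- A concave bump has a second moment about any point `p` comparable with the squared distance of
`p` to any point of its support. -/
theorem sq_mul_integral_le_of_concaveOn {a b : ℝ} (hab : a ≤ b) {φ : ℝ → ℝ}
    (hφ : ConcaveOn ℝ (Icc a b) φ) (hc : Continuous φ) {y₀ : ℝ} (hy₀ : y₀ ∈ Icc a b)
    (hφ₀ : 0 ≤ φ y₀) (p : ℝ) :
    (y₀ - p) ^ 2 * ∫ y in Icc a b, max (φ y) 0 ≤
      48 * ∫ y in Icc a b, (y - p) ^ 2 * max (φ y) 0 := by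
  set F : ℝ → ℝ := fun y => (y - p) ^ 2 * max (φ y) 0 with hF
  have hFc : Continuous F := by fun_prop
  have hF0 : ∀ y, 0 ≤ F y := fun y => mul_nonneg (sq_nonneg _) (le_max_right _ _)
  simp only [integral_Icc_eq_integral_Ioc, ← intervalIntegral.integral_of_le hab]
  -- The map `y ↦ (y + y₀) / 2` contracts `[a, b]` into itself with Jacobian `1/2`.
  have hsub : ∫ y in a..b, F (2⁻¹ * y + y₀ / 2) ≤ 2 * ∫ y in a..b, F y := by
    rw [intervalIntegral.integral_comp_mul_add F (by norm_num)]
    simp only [inv_inv, smul_eq_mul]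
    refine mul_le_mul_of_nonneg_left ?_ zero_le_two
    refine intervalIntegral.integral_mono_interval (by linarith [hy₀.1]) (by linarith)
      (by linarith [hy₀.2]) (.of_forall hF0) (hFc.intervalIntegrable _ _)
  -- With `z` the midpoint of `y` and `y₀`, `y₀ - p = 2 (z - p) - (y - p)`, while concavity gives `φ
  -- z ≥ φ y / 2`: either `z` or `y` is far from `p`. With the factor `2` from the substitution, the
  -- constant is `16 * (2 + 1) = 48`.
  have hpt : ∀ y ∈ Icc a b,
      (y₀ - p) ^ 2 / 16 * max (φ y) 0 ≤ F (2⁻¹ * y + y₀ / 2) + F y := fun y hy => by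
    have hconc := hφ.2 hy hy₀ (by norm_num : (0 : ℝ) ≤ 2⁻¹) (by norm_num : (0 : ℝ) ≤ 2⁻¹)
      (by norm_num)
    simp only [smul_eq_mul] at hconc
    rw [show 2⁻¹ * y + 2⁻¹ * y₀ = 2⁻¹ * y + y₀ / 2 by ring] at hconc
    have hmax : max (φ y) 0 / 2 ≤ max (φ (2⁻¹ * y + y₀ / 2)) 0 := by
      rcases le_total (φ y) 0 with h | h
      · rw [max_eq_right h]; simp
      · rw [max_eq_left h]; exact le_trans (by linarith) (le_max_left _ _)
    have h0 : 0 ≤ max (φ y) 0 := le_max_right _ _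
    have h1 := mul_le_mul_of_nonneg_left hmax (sq_nonneg (2⁻¹ * y + y₀ / 2 - p))
    simp only [hF]
    nlinarith [mul_nonneg h0 (sq_nonneg (y₀ - p + 2 * (y - p))), mul_nonneg h0 (sq_nonneg (y - p))]
  have hcc : Continuous fun y => F (2⁻¹ * y + y₀ / 2) := by fun_prop
  have hmono := intervalIntegral.integral_mono_on (μ := volume) hab
    (Continuous.intervalIntegrable (by fun_prop) _ _)
    ((hcc.add hFc).intervalIntegrable _ _) hpt
  simp only [Pi.add_apply] at hmono
  rw [intervalIntegral.integral_const_mul, intervalIntegral.integral_add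
    (hcc.intervalIntegrable _ _) (hFc.intervalIntegrable _ _)] at hmono
  linarith

theorem sq_mul_integral_le [IsFiniteMeasure μ₁] (h₁ : RegularDensity μ₁ a₁ b₁ u₁ lo₁ hi₁)
    {φ : ℝ → ℝ} (hφ : ConcaveOn ℝ (Icc a₁ b₁) φ) (hc : Continuous φ) {y₀ : ℝ}
    (hy₀ : y₀ ∈ Icc a₁ b₁) (hφ₀ : 0 ≤ φ y₀) (p : ℝ) :
    (y₀ - p) ^ 2 * ∫ y, max (φ y) 0 ∂μ₁ ≤
      48 * hi₁ / lo₁ * ∫ y, (y - p) ^ 2 * max (φ y) 0 ∂μ₁ := by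
  have h1 := h₁.integral_le (φ := fun y => max (φ y) 0) (fun y => le_max_right _ _)
    ((hc.max continuous_const).continuousOn.integrableOn_compact isCompact_Icc)
  have h2 := h₁.le_integral (φ := fun y => (y - p) ^ 2 * max (φ y) 0)
    (fun y => mul_nonneg (sq_nonneg _) (le_max_right _ _)) (h₁.integrable (by fun_prop))
  have h3 := sq_mul_integral_le_of_concaveOn h₁.lt.le hφ hc hy₀ hφ₀ p
  rw [div_mul_eq_mul_div, le_div_iff₀ h₁.lo_pos]
  have h4 := mul_le_mul_of_nonneg_left h1 (sq_nonneg (y₀ - p))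
  have h5 := mul_le_mul_of_nonneg_left h3 h₁.hi_pos.le
  have h6 : (y₀ - p) ^ 2 * ∫ y, max (φ y) 0 ∂μ₁ ≤
      hi₁ * (48 * ∫ y in Icc a₁ b₁, (y - p) ^ 2 * max (φ y) 0) := by linarith
  have h7 := mul_le_mul_of_nonneg_right h6 h₁.lo_pos.le
  have h8 := mul_le_mul_of_nonneg_left h2 (mul_nonneg (by norm_num : (0 : ℝ) ≤ 48) h₁.hi_pos.le)
  linarith

/-! ### The energy inequality. -/

theorem integral_fst_mul [SFinite μ₀] [SFinite μ₁] {φ : ℝ → ℝ} {q : ℝ × ℝ → ℝ}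
    (hi : Integrable (fun z : ℝ × ℝ => φ z.1 * q z) (μ₀.prod μ₁)) {c : ℝ}
    (hq : ∀ᵐ x ∂μ₀, ∫ y, q (x, y) ∂μ₁ = c) :
    ∫ z, φ z.1 * q z ∂(μ₀.prod μ₁) = c * ∫ x, φ x ∂μ₀ := by
  rw [integral_prod _ hi, ← integral_const_mul]
  refine integral_congr_ae ?_
  filter_upwards [hq] with x hx
  rw [integral_const_mul, hx, mul_comm]

theorem integral_snd_mul [SFinite μ₀] [SFinite μ₁] {ψ : ℝ → ℝ} {q : ℝ × ℝ → ℝ}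
    (hi : Integrable (fun z : ℝ × ℝ => ψ z.2 * q z) (μ₀.prod μ₁)) {c : ℝ}
    (hq : ∀ᵐ y ∂μ₁, ∫ x, q (x, y) ∂μ₀ = c) :
    ∫ z, ψ z.2 * q z ∂(μ₀.prod μ₁) = c * ∫ y, ψ y ∂μ₁ := by
  rw [integral_prod_symm _ hi, ← integral_const_mul]
  refine integral_congr_ae ?_
  filter_upwards [hq] with y hy
  rw [integral_const_mul, hy, mul_comm]

/-- Optimality in the primal regularized problem of the coupling with density `(xy - f - g)₊ / ε`,
against couplings with a bounded density. -/
theorem RegularPotentials.energy_le [IsProbabilityMeasure μ₀] [IsProbabilityMeasure μ₁]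
    (h₀ : RegularDensity μ₀ a₀ b₀ u₀ lo₀ hi₀) (h₁ : RegularDensity μ₁ a₁ b₁ u₁ lo₁ hi₁)
    {ε : ℝ} (hε : 0 < ε) {f g : ℝ → ℝ}
    (h : RegularPotentials μ₀ μ₁ (Icc a₀ b₀) (Icc a₁ b₁) ε f g)
    {T R : ℝ → ℝ} {m M : ℝ} (hTR : BiLipschitzPair T R m M)
    {q : ℝ × ℝ → ℝ} (hq : Measurable q) (hq0 : ∀ z, 0 ≤ q z) {B : ℝ} (hqB : ∀ z, q z ≤ B)
    (hq₁ : ∀ᵐ x ∂μ₀, ∫ y, q (x, y) ∂μ₁ = 1) (hq₂ : ∀ᵐ y ∂μ₁, ∫ x, q (x, y) ∂μ₀ = 1) :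
    ∫ z : ℝ × ℝ, gap T R z.1 z.2 * max (z.1 * z.2 - f z.1 - g z.2) 0 ∂(μ₀.prod μ₁) +
        2⁻¹ * ∫ z : ℝ × ℝ, max (z.1 * z.2 - f z.1 - g z.2) 0 ^ 2 ∂(μ₀.prod μ₁) ≤
      ε * ∫ z : ℝ × ℝ, (gap T R z.1 z.2 * q z + ε / 2 * q z ^ 2) ∂(μ₀.prod μ₁) := by
  have hf := h.continuous_left
  have hg := h.continuous_right
  have hsc := hTR.continuous_sourcePotential
  have htc := hTR.continuous_targetPotential
  have hgc := hTR.continuous_gap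
  set K : ℝ × ℝ → ℝ := fun z => max (z.1 * z.2 - f z.1 - g z.2) 0 with hK
  have hKc : Continuous K := by fun_prop
  set φ : ℝ → ℝ := fun x => sourcePotential T R x - f x with hφ
  set ψ : ℝ → ℝ := fun y => targetPotential R y - g y with hψ
  have hφc : Continuous φ := by fun_prop
  have hψc : Continuous ψ := by fun_prop
  have hbd : ∀ᵐ z ∂(μ₀.prod μ₁), ‖q z‖ ≤ B := .of_forall fun z => by
    rw [Real.norm_eq_abs, abs_of_nonneg (hq0 z)]; exact hqB z
  have hmulq : ∀ {F : ℝ × ℝ → ℝ}, Continuous F → Integrable (fun z => F z * q z) (μ₀.prod μ₁) :=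
    fun hF => (h₀.integrable_prod h₁ hF).mul_bdd hq.aestronglyMeasurable hbd
  have hq2 : Integrable (fun z => q z ^ 2) (μ₀.prod μ₁) := by
    have h1 : Integrable q (μ₀.prod μ₁) := by simpa using hmulq (F := fun _ => 1) continuous_const
    simpa [sq] using h1.mul_bdd hq.aestronglyMeasurable hbd
  have hK₁ : ∀ᵐ x ∂μ₀, ∫ y, K (x, y) ∂μ₁ = ε := by
    filter_upwards [h₀.ae_mem] with x hx using h.integral_right x hx
  have hK₂ : ∀ᵐ y ∂μ₁, ∫ x, K (x, y) ∂μ₀ = ε := by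
    filter_upwards [h₁.ae_mem] with y hy using h.integral_left y hy
  have hi1 : Integrable (fun z : ℝ × ℝ => φ z.1 * q z) (μ₀.prod μ₁) := hmulq (by fun_prop)
  have hi2 : Integrable (fun z : ℝ × ℝ => ψ z.2 * q z) (μ₀.prod μ₁) := hmulq (by fun_prop)
  have hi3 : Integrable (fun z : ℝ × ℝ => φ z.1 * K z) (μ₀.prod μ₁) :=
    h₀.integrable_prod h₁ (by fun_prop)
  have hi4 : Integrable (fun z : ℝ × ℝ => ψ z.2 * K z) (μ₀.prod μ₁) :=
    h₀.integrable_prod h₁ (by fun_prop)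
  have hi5 : Integrable (fun z : ℝ × ℝ => gap T R z.1 z.2 * K z) (μ₀.prod μ₁) :=
    h₀.integrable_prod h₁ (by fun_prop)
  have hi6 : Integrable (fun z : ℝ × ℝ => 2⁻¹ * K z ^ 2) (μ₀.prod μ₁) :=
    h₀.integrable_prod h₁ (by fun_prop)
  have hi7 : Integrable (fun z : ℝ × ℝ => gap T R z.1 z.2 * q z + ε / 2 * q z ^ 2)
    (μ₀.prod μ₁) := (hmulq hgc).add (hq2.const_mul _)
  -- Where `s ≥ 0` the two sides differ by `(s - ε q)² / 2`. The terms in `φ` and `ψ` cancel after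
  -- integration, since `K` and `ε q` have the same marginals.
  have hpt : ∀ z : ℝ × ℝ, gap T R z.1 z.2 * K z + 2⁻¹ * K z ^ 2 ≤
      ε * (gap T R z.1 z.2 * q z + ε / 2 * q z ^ 2) +
        ((φ z.1 * K z + ψ z.2 * K z) - ε * (φ z.1 * q z + ψ z.2 * q z)) := fun z => by
    have hgap : gap T R z.1 z.2 = φ z.1 + ψ z.2 - (z.1 * z.2 - f z.1 - g z.2) := by
      simp only [gap, hφ, hψ]; ring
    have hKz : K z = max (z.1 * z.2 - f z.1 - g z.2) 0 := rfl
    rw [hgap]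
    set s := z.1 * z.2 - f z.1 - g z.2
    rcases le_total s 0 with hs | hs
    · rw [hKz, max_eq_right hs]
      nlinarith [mul_nonneg (mul_nonneg hε.le (hq0 z)) (neg_nonneg.2 hs), sq_nonneg (ε * q z)]
    · rw [hKz, max_eq_left hs]
      nlinarith [sq_nonneg (s - ε * q z)]
  have hi8 : Integrable (fun z : ℝ × ℝ => φ z.1 * K z + ψ z.2 * K z) (μ₀.prod μ₁) := hi3.add hi4
  have hi9 : Integrable (fun z : ℝ × ℝ => ε * (φ z.1 * q z + ψ z.2 * q z)) (μ₀.prod μ₁) :=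
    (hi1.add hi2).const_mul ε
  have hi10 : Integrable (fun z : ℝ × ℝ => (φ z.1 * K z + ψ z.2 * K z) -
    ε * (φ z.1 * q z + ψ z.2 * q z)) (μ₀.prod μ₁) := hi8.sub hi9
  have hmono := integral_mono (hi5.add hi6) ((hi7.const_mul ε).add hi10) hpt
  simp only [Pi.add_apply] at hmono
  rw [integral_add hi5 hi6, integral_add (hi7.const_mul ε) hi10, integral_sub hi8 hi9,
    integral_const_mul, integral_const_mul, integral_const_mul,
    integral_add hi3 hi4, integral_add hi1 hi2, integral_fst_mul hi3 hK₁, integral_snd_mul hi4 hK₂,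
    integral_fst_mul hi1 hq₁, integral_snd_mul hi2 hq₂] at hmono
  linarith

/-! ### The block coupling and the energy rate. -/

theorem RegularDensity.measureReal_floor_cdf {μ : Measure ℝ} [IsProbabilityMeasure μ] {a b : ℝ}
    {u : ℝ → ℝ} {lo hi : ℝ} (h : RegularDensity μ a b u lo hi) {N : ℕ} (hN : 0 < N) {t : ℝ}
    (ht : t ∈ Ico (0 : ℝ) 1) :
    μ.real {y | ⌊(N : ℝ) * h.cdf y⌋ = ⌊(N : ℝ) * t⌋} = (N : ℝ)⁻¹ := by
  have hN' : (0 : ℝ) < N := by exact_mod_cast hN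
  set k := ⌊(N : ℝ) * t⌋
  have hk0 : (0 : ℝ) ≤ k := by
    exact_mod_cast Int.floor_nonneg.2 (mul_nonneg hN'.le ht.1)
  have hk1 : (k : ℝ) + 1 ≤ N := by
    have : k < (N : ℤ) := Int.floor_lt.2 (by push_cast; nlinarith [ht.2])
    exact_mod_cast this
  have hset : {y | ⌊(N : ℝ) * h.cdf y⌋ = k} = h.cdf ⁻¹' Ico (k / N : ℝ) ((k + 1) / N) := by
    ext y
    simp only [mem_ofPred_eq, mem_preimage, mem_Ico, Int.floor_eq_iff, div_le_iff₀ hN',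
      lt_div_iff₀ hN', mul_comm]
  have hsub : Ico (k / N : ℝ) ((k + 1) / N) ⊆ Icc 0 1 := fun v hv =>
    ⟨(div_nonneg hk0 hN'.le).trans hv.1, hv.2.le.trans ((div_le_one hN').2 hk1)⟩
  rw [measureReal_def, hset, ← Measure.map_apply h.continuous_cdf.measurable measurableSet_Ico,
    h.map_cdf, Measure.restrict_apply measurableSet_Ico, inter_eq_left.2 hsub, Real.volume_Ico,
    ENNReal.toReal_ofReal]
  · field_simp; ring
  · rw [sub_nonneg]; gcongr; linarith

theorem RegularDensity.ae_cdf_mem {μ : Measure ℝ} [IsProbabilityMeasure μ] {a b : ℝ}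
    {u : ℝ → ℝ} {lo hi : ℝ} (h : RegularDensity μ a b u lo hi) :
    ∀ᵐ x ∂μ, h.cdf x ∈ Ico (0 : ℝ) 1 := by
  -- The endpoint `b` is discarded: its distribution value `1` would fall in a block of index `N`,
  -- which carries no mass.
  filter_upwards [h.ae_mem, measure_eq_zero_iff_ae_notMem.1
    (h.finite_eq_zero (finite_singleton b))] with x hx hxb
  refine ⟨?_, ?_⟩
  · rw [← h.cdf_left]; exact h.strictMono_cdf.monotone hx.1
  · rw [← h.cdf_right]; exact h.strictMono_cdf (lt_of_le_of_ne hx.2 hxb)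

open Classical in
/-- The density of the coupling which is a product on each of `N` blocks of equal mass. -/
noncomputable def blockDensity (F₀ F₁ : ℝ → ℝ) (N : ℕ) (z : ℝ × ℝ) : ℝ :=
  if ⌊(N : ℝ) * F₀ z.1⌋ = ⌊(N : ℝ) * F₁ z.2⌋ then (N : ℝ) else 0

theorem blockDensity_integral {μ : Measure ℝ} [IsProbabilityMeasure μ] {a b : ℝ}
    {u : ℝ → ℝ} {lo hi : ℝ} (h : RegularDensity μ a b u lo hi) {N : ℕ} (hN : 0 < N)
    {F₀ : ℝ → ℝ} {x : ℝ} (hx : F₀ x ∈ Ico (0 : ℝ) 1) :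
    ∫ y, blockDensity F₀ h.cdf N (x, y) ∂μ = 1 := by
  have hm : MeasurableSet {y | ⌊(N : ℝ) * h.cdf y⌋ = ⌊(N : ℝ) * F₀ x⌋} := by
    have := (h.continuous_cdf.measurable.const_mul (N : ℝ)).floor
    exact this (measurableSet_singleton _)
  have heq : (fun y => blockDensity F₀ h.cdf N (x, y)) =
      indicator {y | ⌊(N : ℝ) * h.cdf y⌋ = ⌊(N : ℝ) * F₀ x⌋} fun _ => (N : ℝ) := by
    ext y
    simp only [blockDensity, indicator, mem_ofPred_eq, eq_comm]
  rw [heq, integral_indicator_const _ hm, h.measureReal_floor_cdf hN hx, smul_eq_mul,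
    inv_mul_cancel₀ (by exact_mod_cast hN.ne')]

theorem blockDensity_swap (F₀ F₁ : ℝ → ℝ) (N : ℕ) (x y : ℝ) :
    blockDensity F₀ F₁ N (x, y) = blockDensity F₁ F₀ N (y, x) := by
  simp only [blockDensity, eq_comm]

theorem RegularPotentials.energy_le_block [IsProbabilityMeasure μ₀] [IsProbabilityMeasure μ₁]
    (h₀ : RegularDensity μ₀ a₀ b₀ u₀ lo₀ hi₀) (h₁ : RegularDensity μ₁ a₁ b₁ u₁ lo₁ hi₁)
    {ε : ℝ} (hε : 0 < ε) {f g : ℝ → ℝ}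
    (h : RegularPotentials μ₀ μ₁ (Icc a₀ b₀) (Icc a₁ b₁) ε f g)
    {T R : ℝ → ℝ} {m M : ℝ} (hTR : BiLipschitzPair T R m M)
    (hT : ∀ x, h₁.cdf (T x) = h₀.cdf x) {N : ℕ} (hN : 0 < N) :
    ∫ z : ℝ × ℝ, gap T R z.1 z.2 * max (z.1 * z.2 - f z.1 - g z.2) 0 ∂(μ₀.prod μ₁) +
        2⁻¹ * ∫ z : ℝ × ℝ, max (z.1 * z.2 - f z.1 - g z.2) 0 ^ 2 ∂(μ₀.prod μ₁) ≤
      ε * (M / 2 * (1 / (lo₁ * N)) ^ 2 + ε / 2 * N) := by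
  have hN' : (0 : ℝ) < N := by exact_mod_cast hN
  set q := blockDensity h₀.cdf h₁.cdf N with hq
  have hqm : Measurable q := by
    refine Measurable.ite (measurableSet_eq_fun ?_ ?_) measurable_const measurable_const
    · exact ((h₀.continuous_cdf.measurable.comp measurable_fst).const_mul _).floor
    · exact ((h₁.continuous_cdf.measurable.comp measurable_snd).const_mul _).floor
  have hq0 : ∀ z, 0 ≤ q z := fun z => by
    simp only [hq, blockDensity]; split_ifs <;> simp
  have hqB : ∀ z, q z ≤ N := fun z => by
    simp only [hq, blockDensity]; split_ifs <;> simp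
  have hq₁ : ∀ᵐ x ∂μ₀, ∫ y, q (x, y) ∂μ₁ = 1 := by
    filter_upwards [h₀.ae_cdf_mem] with x hx using blockDensity_integral h₁ hN hx
  have hq₂ : ∀ᵐ y ∂μ₁, ∫ x, q (x, y) ∂μ₀ = 1 := by
    filter_upwards [h₁.ae_cdf_mem] with y hy
    simp only [hq, blockDensity_swap h₀.cdf]
    exact blockDensity_integral h₀ hN hy
  refine (h.energy_le h₀ h₁ hε hTR hqm hq0 hqB hq₁ hq₂).trans
    (mul_le_mul_of_nonneg_left ?_ hε.le)
  have hqi : Integrable q (μ₀.prod μ₁) :=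
    (integrable_const (N : ℝ)).mono' hqm.aestronglyMeasurable (.of_forall fun z => by
      rw [Real.norm_eq_abs, abs_of_nonneg (hq0 z)]; exact hqB z)
  have hq1 : ∫ z, q z ∂(μ₀.prod μ₁) = 1 := by
    have := integral_fst_mul (φ := fun _ => 1) (by simpa using hqi) hq₁
    simpa using this
  -- Within a block the distribution values differ by less than `1 / N`, so `y` is within `1 / (lo₁
  -- N)` of `T x`. Also `q² = N q`, as `q` takes only the values `0` and `N`.
  have hpt : ∀ z, gap T R z.1 z.2 * q z + ε / 2 * q z ^ 2 ≤
      (M / 2 * (1 / (lo₁ * N)) ^ 2 + ε / 2 * N) * q z := fun z => by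
    by_cases hz : ⌊(N : ℝ) * h₀.cdf z.1⌋ = ⌊(N : ℝ) * h₁.cdf z.2⌋
    · have hqz : q z = N := by simp only [hq, blockDensity, hz, if_true]
      have habs := Int.abs_sub_lt_one_of_floor_eq_floor hz
      rw [← hT, ← mul_sub, abs_mul, abs_of_pos hN'] at habs
      have hdist : |z.2 - T z.1| ≤ 1 / (lo₁ * N) := by
        rw [le_div_iff₀ (mul_pos h₁.lo_pos hN')]
        have : lo₁ * |z.2 - T z.1| ≤ |h₁.cdf (T z.1) - h₁.cdf z.2| := by
          rcases le_total z.2 (T z.1) with hle | hle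
          · rw [abs_of_nonpos (by linarith)]
            exact le_trans (by linarith [h₁.mul_le_cdf_sub hle]) (le_abs_self _)
          · rw [abs_of_nonneg (by linarith)]
            exact le_trans (by linarith [h₁.mul_le_cdf_sub hle]) (neg_le_abs _)
        nlinarith [mul_le_mul_of_nonneg_left this hN'.le]
      have hgap := (hTR.gap_bounds z.1 z.2).2
      have hsq : (z.2 - T z.1) ^ 2 ≤ (1 / (lo₁ * N)) ^ 2 := by
        rw [← sq_abs]; gcongr
      have hM := hTR.M_pos
      have : gap T R z.1 z.2 ≤ M / 2 * (1 / (lo₁ * N)) ^ 2 :=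
        hgap.trans (mul_le_mul_of_nonneg_left hsq (by positivity))
      rw [hqz]
      nlinarith
    · have hqz : q z = 0 := by simp only [hq, blockDensity, hz, if_false]
      simp [hqz]
  refine (integral_mono_of_nonneg (.of_forall fun z => ?_) (hqi.const_mul _)
    (.of_forall hpt)).trans ?_
  · have := (hTR.gap_bounds z.1 z.2).1
    have h2 : 0 ≤ gap T R z.1 z.2 :=
      le_trans (mul_nonneg (by linarith [hTR.m_pos]) (sq_nonneg _)) this
    have := hq0 z
    simp only [Pi.zero_apply]
    positivity
  · rw [integral_const_mul, hq1, mul_one]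

/-- At the scale `r = ε ^ (1 / 3)` the energy is of order `ε r ^ 2`. -/
theorem RegularPotentials.energy_le_rate [IsProbabilityMeasure μ₀] [IsProbabilityMeasure μ₁]
    (h₀ : RegularDensity μ₀ a₀ b₀ u₀ lo₀ hi₀) (h₁ : RegularDensity μ₁ a₁ b₁ u₁ lo₁ hi₁)
    {r : ℝ} (hr : 0 < r) (hr1 : r < 1) {f g : ℝ → ℝ}
    (h : RegularPotentials μ₀ μ₁ (Icc a₀ b₀) (Icc a₁ b₁) (r ^ 3) f g)
    {T R : ℝ → ℝ} {m M : ℝ} (hTR : BiLipschitzPair T R m M)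
    (hT : ∀ x, h₁.cdf (T x) = h₀.cdf x) :
    ∫ z : ℝ × ℝ, gap T R z.1 z.2 * max (z.1 * z.2 - f z.1 - g z.2) 0 ∂(μ₀.prod μ₁) +
        2⁻¹ * ∫ z : ℝ × ℝ, max (z.1 * z.2 - f z.1 - g z.2) 0 ^ 2 ∂(μ₀.prod μ₁) ≤
      r ^ 3 * ((M / (2 * lo₁ ^ 2) + 1) * r ^ 2) := by
  -- The choice `N ≈ 1 / r` balances the transport error `N⁻²` against the penalty `r³ N`.
  have hN : 0 < ⌈1 / r⌉₊ := Nat.ceil_pos.2 (by positivity)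
  refine (h.energy_le_block h₀ h₁ (by positivity) hTR hT hN).trans
    (mul_le_mul_of_nonneg_left ?_ (by positivity))
  have hle : 1 / r ≤ (⌈1 / r⌉₊ : ℝ) := Nat.le_ceil _
  have hlt : (⌈1 / r⌉₊ : ℝ) < 1 / r + 1 := Nat.ceil_lt_add_one (by positivity)
  set N : ℝ := (⌈1 / r⌉₊ : ℝ)
  have hN0 : 0 < N := lt_of_lt_of_le (by positivity) hle
  have hNr : N * r ≤ 2 := by
    have h1 : (1 / r + 1) * r = 1 + r := by field_simp
    nlinarith
  have hinv : 1 / (lo₁ * N) ≤ r / lo₁ := by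
    have := h₁.lo_pos
    rw [div_le_div_iff₀ (by positivity) this]
    rw [div_le_iff₀ hr] at hle
    nlinarith
  have hsq : (1 / (lo₁ * N)) ^ 2 ≤ (r / lo₁) ^ 2 := by
    have := h₁.lo_pos
    gcongr
  have hM := hTR.M_pos
  have h2 : M / 2 * (1 / (lo₁ * N)) ^ 2 ≤ M / (2 * lo₁ ^ 2) * r ^ 2 := by
    refine (mul_le_mul_of_nonneg_left hsq (by positivity)).trans_eq ?_
    field_simp
  have h3 : r ^ 3 / 2 * N ≤ r ^ 2 := by nlinarith [mul_le_mul_of_nonneg_left hNr (sq_nonneg r)]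
  linarith

/-! ### Distance of the sections to the map: measurability and the two integral bounds. -/

theorem hausdorffDist_singleton_spec {S : Set ℝ} (hS : IsCompact S) (hne : S.Nonempty) (t : ℝ) :
    (∀ y ∈ S, |y - t| ≤ Metric.hausdorffDist S {t}) ∧
      ∃ y ∈ S, Metric.hausdorffDist S {t} = |y - t| := by
  have hfin : Metric.hausdorffEDist S {t} ≠ ⊤ :=
    Metric.hausdorffEDist_ne_top_of_nonempty_of_bounded hne (singleton_nonempty t) hS.isBounded
      Bornology.isBounded_singleton
  have hle : ∀ y ∈ S, |y - t| ≤ Metric.hausdorffDist S {t} := fun y hy => by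
    have := Metric.infDist_le_hausdorffDist_of_mem hy hfin
    rwa [Metric.infDist_singleton, Real.dist_eq] at this
  refine ⟨hle, ?_⟩
  obtain ⟨y, hy, hmax⟩ := hS.exists_isMaxOn hne
    (f := fun y => |y - t|) (by fun_prop)
  refine ⟨y, hy, le_antisymm ?_ (hle y hy)⟩
  refine Metric.hausdorffDist_le_of_mem_dist (abs_nonneg _) (fun z hz => ⟨t, rfl, hmax hz⟩) ?_
  rintro _ rfl
  exact ⟨y, hy, by rw [dist_comm, Real.dist_eq]⟩

section

variable {ε : ℝ} {f g T R : ℝ → ℝ}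

theorem isCompact_supportSection (hg : Continuous g) (x : ℝ) :
    IsCompact (supportSection (Icc a₁ b₁) f g x) :=
  have hc : Continuous fun y => x * y - f x - g y := by fun_prop
  isCompact_Icc.inter_right (isClosed_le continuous_const hc)

theorem nonempty_supportSection [IsFiniteMeasure μ₁] (h₁ : RegularDensity μ₁ a₁ b₁ u₁ lo₁ hi₁)
    (hε : 0 < ε) {Ω₀ : Set ℝ} (h : RegularPotentials μ₀ μ₁ Ω₀ (Icc a₁ b₁) ε f g) {x : ℝ}
    (hx : x ∈ Ω₀) : (supportSection (Icc a₁ b₁) f g x).Nonempty := by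
  obtain ⟨y, hy, hpos⟩ := exists_pos hε h₁ (h.integral_right x hx)
  exact ⟨y, hy, hpos.le⟩

/-- The Hausdorff distance of the section at `x` to the point `T x`. -/
noncomputable def sectionDist (a₁ b₁ : ℝ) (f g T : ℝ → ℝ) (x : ℝ) : ℝ :=
  Metric.hausdorffDist (supportSection (Icc a₁ b₁) f g x) {T x}

theorem sectionDist_nonneg (x : ℝ) : 0 ≤ sectionDist a₁ b₁ f g T x :=
  Metric.hausdorffDist_nonneg

/-- The distance is attained at a farthest point of the section. So a superlevel set is the
projection of a compact subset of the plane, hence closed. -/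
theorem aemeasurable_sectionDist (hf : Continuous f) (hg : Continuous g) (hT : Continuous T)
    (hne : ∀ x ∈ Icc a₀ b₀, (supportSection (Icc a₁ b₁) f g x).Nonempty) :
    AEMeasurable (sectionDist a₁ b₁ f g T) (volume.restrict (Icc a₀ b₀)) := by
  refine aemeasurable_restrict_of_measurable_subtype measurableSet_Icc
    (measurable_of_Ici fun c => ?_)
  have h1 : Continuous fun z : ℝ × ℝ => z.1 * z.2 - f z.1 - g z.2 := by fun_prop
  have h2 : Continuous fun z : ℝ × ℝ => |z.2 - T z.1| := by fun_prop
  have hK : IsCompact ((Icc a₀ b₀ ×ˢ Icc a₁ b₁) ∩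
      {z : ℝ × ℝ | 0 ≤ z.1 * z.2 - f z.1 - g z.2 ∧ c ≤ |z.2 - T z.1|}) :=
    (isCompact_Icc.prod isCompact_Icc).inter_right
      ((isClosed_le continuous_const h1).inter (isClosed_le continuous_const h2))
  convert (hK.image continuous_fst).isClosed.measurableSet.preimage
    (measurable_subtype_coe (p := fun x => x ∈ Icc a₀ b₀)) using 1
  ext ⟨x, hx⟩
  obtain ⟨hle, y, hy, heq⟩ :=
    hausdorffDist_singleton_spec (isCompact_supportSection hg x) (hne x hx) (T x)
  constructor
  · intro hc
    have hc' : c ≤ Metric.hausdorffDist (supportSection (Icc a₁ b₁) f g x) {T x} := hc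
    exact ⟨(x, y), ⟨⟨hx, hy.1⟩, hy.2, heq ▸ hc'⟩, rfl⟩
  · rintro ⟨⟨x', y'⟩, ⟨⟨-, hy'⟩, hp, hc⟩, rfl⟩
    exact hc.trans (hle y' ⟨hy', hp⟩)

theorem exists_sectionDist_le (hg : Continuous g) (hT : Continuous T)
    (hne : ∀ x ∈ Icc a₀ b₀, (supportSection (Icc a₁ b₁) f g x).Nonempty) :
    ∃ B, ∀ x ∈ Icc a₀ b₀, sectionDist a₁ b₁ f g T x ≤ B := by
  obtain ⟨B, hB⟩ := (isCompact_Icc.prod isCompact_Icc).exists_bound_of_continuousOn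
    (s := Icc a₀ b₀ ×ˢ Icc a₁ b₁) (f := fun z : ℝ × ℝ => z.2 - T z.1) (by fun_prop)
  refine ⟨B, fun x hx => ?_⟩
  obtain ⟨-, y, hy, heq⟩ :=
    hausdorffDist_singleton_spec (isCompact_supportSection hg x) (hne x hx) (T x)
  rw [sectionDist, heq]
  exact hB (x, y) ⟨hx, hy.1⟩

theorem memLp_sectionDist (hf : Continuous f) (hg : Continuous g) (hT : Continuous T)
    (hne : ∀ x ∈ Icc a₀ b₀, (supportSection (Icc a₁ b₁) f g x).Nonempty) :
    MemLp (sectionDist a₁ b₁ f g T) 2 (volume.restrict (Icc a₀ b₀)) := by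
  obtain ⟨B, hB⟩ := exists_sectionDist_le hg hT hne
  refine MemLp.of_bound (aemeasurable_sectionDist hf hg hT hne).aestronglyMeasurable B ?_
  filter_upwards [ae_restrict_mem measurableSet_Icc] with x hx
  rw [Real.norm_eq_abs, abs_of_nonneg (sectionDist_nonneg x)]
  exact hB x hx

theorem abs_barycenter_sub_le [IsFiniteMeasure μ₁] (h₁ : RegularDensity μ₁ a₁ b₁ u₁ lo₁ hi₁)
    (hε : 0 < ε) {Ω₀ : Set ℝ} (h : RegularPotentials μ₀ μ₁ Ω₀ (Icc a₁ b₁) ε f g) {x : ℝ}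
    (hx : x ∈ Ω₀) : |barycenter μ₁ f g x - T x| ≤ sectionDist a₁ b₁ f g T x := by
  have hg := h.continuous_right
  have hpos := measureReal_pos hε (h.integral_right x hx)
  have hA := measurableSet_pos (f := f) hg x
  obtain ⟨hle, -⟩ := hausdorffDist_singleton_spec (isCompact_supportSection hg x)
    (nonempty_supportSection h₁ hε h hx) (T x)
  rw [barycenter]
  set A := {y | 0 < x * y - f x - g y}
  have hb : ∀ᵐ y ∂(μ₁.restrict A), ‖y - T x‖ ≤ sectionDist a₁ b₁ f g T x := by
    filter_upwards [ae_restrict_mem hA, ae_restrict_of_ae h₁.ae_mem] with y hyA hy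
    exact hle y ⟨hy, le_of_lt hyA⟩
  have h2 := norm_setIntegral_le_of_norm_le_const_ae (measure_lt_top μ₁ A) hb
  rw [integral_sub (h₁.integrable continuous_id').integrableOn (by simp), setIntegral_const,
    smul_eq_mul, Real.norm_eq_abs] at h2
  rw [div_sub' hpos.ne', abs_div, abs_of_pos hpos, div_le_iff₀ hpos]
  exact h2

/-- The upper bound for the sections, in integrated form. -/
theorem RegularPotentials.integral_sectionDist_sq_le [IsProbabilityMeasure μ₀]
    [IsProbabilityMeasure μ₁]
    (h₀ : RegularDensity μ₀ a₀ b₀ u₀ lo₀ hi₀) (h₁ : RegularDensity μ₁ a₁ b₁ u₁ lo₁ hi₁)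
    (hε : 0 < ε) (h : RegularPotentials μ₀ μ₁ (Icc a₀ b₀) (Icc a₁ b₁) ε f g)
    {m M : ℝ} (hTR : BiLipschitzPair T R m M) {E : ℝ}
    (hE : ∫ z : ℝ × ℝ, gap T R z.1 z.2 * max (z.1 * z.2 - f z.1 - g z.2) 0 ∂(μ₀.prod μ₁) ≤
      ε * E) :
    ∫ x in Icc a₀ b₀, sectionDist a₁ b₁ f g T x ^ 2 ≤ 96 * hi₁ / (lo₀ * lo₁ * m) * E := by
  have hf := h.continuous_left
  have hg := h.continuous_right
  have hTc := hTR.continuous_map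
  have hgc := hTR.continuous_gap
  have hm := hTR.m_pos
  have hlo₀ := h₀.lo_pos
  have hlo₁ := h₁.lo_pos
  have hhi₁ := h₁.hi_pos
  have hne := fun x hx => nonempty_supportSection h₁ hε h (x := x) hx
  have hLp := memLp_sectionDist hf hg hTc hne
  have hsq : Integrable (fun x => sectionDist a₁ b₁ f g T x ^ 2) μ₀ :=
    h₀.integrable_of_integrableOn hLp.integrable_sq
  have hlow := h₀.le_integral (fun x => sq_nonneg (sectionDist a₁ b₁ f g T x)) hsq
  -- The first factor is the concave-bump constant, and `2 / m` converts `(y - T x)²` into the gap.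
  set c := 48 * hi₁ / lo₁ * (2 / m) with hc
  have hgi : Integrable (fun z : ℝ × ℝ => gap T R z.1 z.2 * max (z.1 * z.2 - f z.1 - g z.2) 0)
    (μ₀.prod μ₁) := h₀.integrable_prod h₁ (by fun_prop)
  have hpt : ∀ᵐ x ∂μ₀, sectionDist a₁ b₁ f g T x ^ 2 * ε ≤
      c * ∫ y, gap T R x y * max (x * y - f x - g y) 0 ∂μ₁ := by
    filter_upwards [h₀.ae_mem] with x hx
    obtain ⟨-, y₀, hy₀, heq⟩ :=
      hausdorffDist_singleton_spec (isCompact_supportSection hg x) (hne x hx) (T x)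
    have h1 := sq_mul_integral_le h₁ (concaveOn_section (f := f) h.convexOn_right x)
      (by fun_prop) hy₀.1 hy₀.2 (T x)
    rw [h.integral_right x hx] at h1
    rw [sectionDist, heq, sq_abs, hc, mul_assoc]
    refine h1.trans (mul_le_mul_of_nonneg_left ?_ (by positivity))
    have hgx : Continuous fun y => gap T R x y :=
      hgc.comp (continuous_const.prodMk continuous_id)
    rw [← integral_const_mul]
    refine integral_mono (h₁.integrable (by fun_prop)) (h₁.integrable (by fun_prop)) fun y => ?_
    simp only
    rw [← mul_assoc]
    refine mul_le_mul_of_nonneg_right ?_ (le_max_right _ _)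
    have := (hTR.gap_bounds x y).1
    rw [div_mul_eq_mul_div, le_div_iff₀ hm]
    linarith
  have hint := integral_mono_ae (hsq.mul_const ε) (hgi.integral_prod_left.const_mul c) hpt
  rw [integral_mul_const, integral_const_mul, ← integral_prod _ hgi] at hint
  have hc0 : 0 < c := by positivity
  have h3 : (∫ x, sectionDist a₁ b₁ f g T x ^ 2 ∂μ₀) ≤ c * E := by
    have h4 := hint.trans (mul_le_mul_of_nonneg_left hE hc0.le)
    refine le_of_mul_le_mul_right (a := ε) ?_ hε
    linarith
  have h5 : 96 * hi₁ / (lo₀ * lo₁ * m) * E = c * E / lo₀ := by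
    rw [hc]; field_simp; ring
  rw [h5, le_div_iff₀ hlo₀]
  linarith

/-- Cauchy–Schwarz against `1`, obtained by expanding the variance about the mean `s`. -/
theorem sq_integral_le_mul_integral_sq {φ : ℝ → ℝ} {a b : ℝ} (hab : a < b)
    (hφ : MemLp φ 2 (volume.restrict (Icc a b))) :
    (∫ x in Icc a b, φ x) ^ 2 ≤ (b - a) * ∫ x in Icc a b, φ x ^ 2 := by
  have hi : Integrable φ (volume.restrict (Icc a b)) := hφ.integrable (by norm_num)
  set s := (∫ x in Icc a b, φ x) / (b - a) with hs
  have hab' : 0 < b - a := sub_pos.2 hab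
  have h0 : 0 ≤ ∫ x in Icc a b, (φ x ^ 2 - 2 * s * φ x + s ^ 2) :=
    integral_nonneg fun x => by
      have := sq_nonneg (φ x - s)
      simp only [Pi.zero_apply]; nlinarith
  have hi1 : Integrable (fun x => φ x ^ 2 - 2 * s * φ x) (volume.restrict (Icc a b)) :=
    hφ.integrable_sq.sub (hi.const_mul _)
  rw [integral_add hi1 (integrable_const _), integral_sub hφ.integrable_sq (hi.const_mul _),
    integral_const_mul, setIntegral_const, measureReal_def, Real.volume_Icc,
    ENNReal.toReal_ofReal hab'.le, smul_eq_mul] at h0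
  have h1 : ∫ x in Icc a b, φ x = s * (b - a) := by rw [hs]; field_simp
  rw [h1] at h0 ⊢
  nlinarith

/-- The lower bound for the sections, in integrated form. -/
theorem RegularPotentials.le_integral_sectionDist [IsProbabilityMeasure μ₀]
    [IsProbabilityMeasure μ₁]
    (h₀ : RegularDensity μ₀ a₀ b₀ u₀ lo₀ hi₀) (h₁ : RegularDensity μ₁ a₁ b₁ u₁ lo₁ hi₁)
    (hε : 0 < ε) (h : RegularPotentials μ₀ μ₁ (Icc a₀ b₀) (Icc a₁ b₁) ε f g)
    (hT : Continuous T) {E : ℝ} (hE0 : 0 < E)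
    (hE : ∫ z : ℝ × ℝ, max (z.1 * z.2 - f z.1 - g z.2) 0 ^ 2 ∂(μ₀.prod μ₁) ≤ 2 * ε * E) :
    ε ≤ 4 * hi₀ * hi₁ * E * ∫ x in Icc a₀ b₀, sectionDist a₁ b₁ f g T x := by
  have hf := h.continuous_left
  have hg := h.continuous_right
  have hhi₁ := h₁.hi_pos
  have hne := fun x hx => nonempty_supportSection h₁ hε h (x := x) hx
  have hLp := memLp_sectionDist hf hg hT hne
  have hdi := hLp.integrable (by norm_num)
  have hd : Integrable (sectionDist a₁ b₁ f g T) μ₀ := h₀.integrable_of_integrableOn hdi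
  have hup := h₀.integral_le (fun x => sectionDist_nonneg (a₁ := a₁) (b₁ := b₁)
    (f := f) (g := g) (T := T) x) hdi
  have hKi : Integrable (fun z : ℝ × ℝ => max (z.1 * z.2 - f z.1 - g z.2) 0 ^ 2)
    (μ₀.prod μ₁) := h₀.integrable_prod h₁ (by fun_prop)
  -- Young's inequality `k ≤ k² / (4E) + E`, used only on the section, whose `μ₁`-mass is at most `2
  -- hi₁ d`. After integration in `x` the quadratic term costs at most `ε / 2` and is absorbed.
  have hpt : ∀ᵐ x ∂μ₀, ε ≤ 1 / (4 * E) * (∫ y, max (x * y - f x - g y) 0 ^ 2 ∂μ₁) +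
      2 * E * hi₁ * sectionDist a₁ b₁ f g T x := by
    filter_upwards [h₀.ae_mem] with x hx
    obtain ⟨hle, -⟩ :=
      hausdorffDist_singleton_spec (isCompact_supportSection hg x) (hne x hx) (T x)
    set d := sectionDist a₁ b₁ f g T x with hddef
    have hd0 : 0 ≤ d := sectionDist_nonneg x
    have hvol := h₁.integral_le (φ := indicator (Icc (T x - d) (T x + d)) fun _ => (1 : ℝ))
      (fun y => indicator_nonneg (fun _ _ => zero_le_one) y)
      ((integrable_const (1 : ℝ)).indicator measurableSet_Icc)
    have hvol2 : ∫ y in Icc a₁ b₁, indicator (Icc (T x - d) (T x + d)) (fun _ => (1 : ℝ)) y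
        ≤ 2 * d := by
      rw [integral_indicator_const _ measurableSet_Icc, smul_eq_mul, mul_one, measureReal_def]
      refine ENNReal.toReal_le_of_le_ofReal (by positivity) ?_
      refine (Measure.restrict_apply_le _ _).trans ?_
      rw [Real.volume_Icc]
      exact ENNReal.ofReal_le_ofReal (by linarith)
    have hind : Integrable (indicator (Icc (T x - d) (T x + d)) fun _ => (1 : ℝ)) μ₁ :=
      (integrable_const (1 : ℝ)).indicator measurableSet_Icc
    have hsqi : Integrable (fun y => max (x * y - f x - g y) 0 ^ 2) μ₁ :=
      h₁.integrable (by fun_prop)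
    have hmono : ∫ y, max (x * y - f x - g y) 0 ∂μ₁ ≤
        ∫ y, (1 / (4 * E) * max (x * y - f x - g y) 0 ^ 2 +
          E * indicator (Icc (T x - d) (T x + d)) (fun _ => (1 : ℝ)) y) ∂μ₁ := by
      refine integral_mono_ae (h₁.integrable (by fun_prop))
        ((hsqi.const_mul _).add (hind.const_mul _)) ?_
      filter_upwards [h₁.ae_mem] with y hy
      rcases le_total (x * y - f x - g y) 0 with hs | hs
      · rw [max_eq_right hs]
        have : 0 ≤ indicator (Icc (T x - d) (T x + d)) (fun _ => (1 : ℝ)) y :=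
          indicator_nonneg (fun _ _ => zero_le_one) y
        positivity
      · have hyd := abs_le.1 (hle y ⟨hy, hs⟩)
        have hmem : y ∈ Icc (T x - d) (T x + d) := by
          rw [hddef, sectionDist]; exact ⟨by linarith [hyd.1], by linarith [hyd.2]⟩
        rw [max_eq_left hs, indicator_of_mem hmem]
        set k := x * y - f x - g y
        have hk := sq_nonneg (k - 2 * E)
        have : 1 / (4 * E) * k ^ 2 + E * 1 - k = (k - 2 * E) ^ 2 / (4 * E) := by
          field_simp; ring
        have : 0 ≤ (k - 2 * E) ^ 2 / (4 * E) := by positivity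
        linarith
    rw [h.integral_right x hx, integral_add (hsqi.const_mul _) (hind.const_mul _),
      integral_const_mul, integral_const_mul] at hmono
    have h1 := mul_le_mul_of_nonneg_left (hvol.trans
      (mul_le_mul_of_nonneg_left hvol2 hhi₁.le)) hE0.le
    linarith
  have hint := integral_mono_ae (integrable_const ε)
    ((hKi.integral_prod_left.const_mul (1 / (4 * E))).add (hd.const_mul (2 * E * hi₁))) hpt
  simp only [Pi.add_apply] at hint
  rw [integral_add (hKi.integral_prod_left.const_mul _) (hd.const_mul _), integral_const_mul,
    integral_const_mul, ← integral_prod _ hKi] at hint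
  simp only [integral_const, probReal_univ, smul_eq_mul, one_mul] at hint
  have h1 : 1 / (4 * E) * ∫ z : ℝ × ℝ, max (z.1 * z.2 - f z.1 - g z.2) 0 ^ 2 ∂(μ₀.prod μ₁) ≤
      ε / 2 := by
    refine (mul_le_mul_of_nonneg_left hE (by positivity)).trans_eq ?_
    field_simp; ring
  have h2 := mul_le_mul_of_nonneg_left hup (by positivity : 0 ≤ 2 * E * hi₁)
  linarith

end

/-! ### Passage to `L²` norms and conclusion. -/

theorem eLpNorm_two_eq {φ : ℝ → ℝ} {ν : Measure ℝ} (hφ : MemLp φ 2 ν) :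
    eLpNorm φ 2 ν = ENNReal.ofReal (√(∫ x, φ x ^ 2 ∂ν)) := by
  rw [hφ.eLpNorm_eq_integral_rpow_norm (by norm_num) (by norm_num), Real.sqrt_eq_rpow]
  simp

theorem IsPotentialPair.exists_regularPotentials [IsProbabilityMeasure μ₀]
    [IsProbabilityMeasure μ₁]
    (h₀ : RegularDensity μ₀ a₀ b₀ u₀ lo₀ hi₀) (h₁ : RegularDensity μ₁ a₁ b₁ u₁ lo₁ hi₁)
    {ε : ℝ} (hε : 0 < ε) {f g : ℝ → ℝ} (h : IsPotentialPair μ₀ μ₁ (Icc a₀ b₀) (Icc a₁ b₁) ε f g) :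
    ∃ f' g', EqOn f f' (Icc a₀ b₀) ∧ EqOn g g' (Icc a₁ b₁) ∧
      RegularPotentials μ₀ μ₁ (Icc a₀ b₀) (Icc a₁ b₁) ε f' g' := by
  obtain ⟨hf, hg, hsol⟩ := h
  have hef : EqOn f (IccExtend h₀.lt.le fun x => f x) (Icc a₀ b₀) := fun x hx =>
    (IccExtend_of_mem h₀.lt.le (fun x => f x) hx).symm
  have heg : EqOn g (IccExtend h₁.lt.le fun x => g x) (Icc a₁ b₁) := fun x hx =>
    (IccExtend_of_mem h₁.lt.le (fun x => g x) hx).symm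
  refine ⟨_, _, hef, heg, (hsol.congr ?_ ?_).regularPotentials h₀ h₁ hε
    (continuousOn_iff_continuous_domRestrict.1 hf).Icc_extend'
    (continuousOn_iff_continuous_domRestrict.1 hg).Icc_extend'⟩
  · filter_upwards [h₀.ae_mem] with x hx
    rw [hef hx]
  · filter_upwards [h₁.ae_mem] with y hy
    rw [heg hy]

/-- The convergence rate for regular potentials and the monotone rearrangement `T`, at the scale
`r = ε ^ (1 / 3)`. -/
theorem exists_rate [IsProbabilityMeasure μ₀] [IsProbabilityMeasure μ₁]
    (h₀ : RegularDensity μ₀ a₀ b₀ u₀ lo₀ hi₀) (h₁ : RegularDensity μ₁ a₁ b₁ u₁ lo₁ hi₁)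
    {T R : ℝ → ℝ} {m M : ℝ} (hTR : BiLipschitzPair T R m M)
    (hT : ∀ x, h₁.cdf (T x) = h₀.cdf x) :
    ∃ C, 0 < C ∧ ∀ r : ℝ, 0 < r → r < 1 → ∀ f g : ℝ → ℝ,
      RegularPotentials μ₀ μ₁ (Icc a₀ b₀) (Icc a₁ b₁) (r ^ 3) f g →
      C⁻¹ * r ≤ √(∫ x in Icc a₀ b₀, sectionDist a₁ b₁ f g T x ^ 2) ∧
        √(∫ x in Icc a₀ b₀, sectionDist a₁ b₁ f g T x ^ 2) ≤ C * r := by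
  have hlo₀ := h₀.lo_pos
  have hlo₁ := h₁.lo_pos
  have hhi₀ := h₀.hi_pos
  have hhi₁ := h₁.hi_pos
  have hm := hTR.m_pos
  have hM := hTR.M_pos
  have hab : 0 < b₀ - a₀ := sub_pos.2 h₀.lt
  set E := M / (2 * lo₁ ^ 2) + 1 with hEdef
  have hE : 0 < E := by positivity
  set C₁ := 4 * hi₀ * hi₁ * E * √(b₀ - a₀) with hC₁
  set C₂ := √(96 * hi₁ / (lo₀ * lo₁ * m) * E) with hC₂
  have hC₁0 : 0 < C₁ := by positivity
  refine ⟨max C₁ C₂, lt_max_of_lt_left hC₁0, fun r hr hr1 f g h => ?_⟩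
  have hr3 : 0 < r ^ 3 := by positivity
  have hen := h.energy_le_rate h₀ h₁ hr hr1 hTR hT
  have hn1 : 0 ≤ ∫ z : ℝ × ℝ, gap T R z.1 z.2 * max (z.1 * z.2 - f z.1 - g z.2) 0
      ∂(μ₀.prod μ₁) := integral_nonneg fun z =>
    mul_nonneg (le_trans (by positivity) (hTR.gap_bounds z.1 z.2).1) (le_max_right _ _)
  have hn2 : 0 ≤ ∫ z : ℝ × ℝ, max (z.1 * z.2 - f z.1 - g z.2) 0 ^ 2 ∂(μ₀.prod μ₁) :=
    integral_nonneg fun z => sq_nonneg _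
  have hup := h.integral_sectionDist_sq_le h₀ h₁ hr3 hTR (E := E * r ^ 2) (by linarith)
  have hlow := h.le_integral_sectionDist h₀ h₁ hr3 hTR.continuous_map (E := E * r ^ 2)
    (by positivity) (by linarith)
  have hLp := memLp_sectionDist h.continuous_left h.continuous_right hTR.continuous_map
    fun x hx => nonempty_supportSection h₁ hr3 h (x := x) hx
  have hcs := sq_integral_le_mul_integral_sq h₀.lt hLp
  set Q := ∫ x in Icc a₀ b₀, sectionDist a₁ b₁ f g T x ^ 2
  set I := ∫ x in Icc a₀ b₀, sectionDist a₁ b₁ f g T x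
  constructor
  · have hI : I ≤ √(b₀ - a₀) * √Q := by
      rw [← Real.sqrt_mul hab.le]; exact Real.le_sqrt_of_sq_le hcs
    -- The lower bound reads `r³ ≤ C r² I`; cancelling `r²` leaves the rate.
    have h1 : r ≤ 4 * hi₀ * hi₁ * E * I := by
      refine le_of_mul_le_mul_right (a := r ^ 2) ?_ (by positivity)
      linarith
    have h2 : r ≤ C₁ * √Q := by
      refine h1.trans ((mul_le_mul_of_nonneg_left hI (by positivity)).trans_eq ?_)
      rw [hC₁]; ring
    have hC : 0 < max C₁ C₂ := lt_max_of_lt_left hC₁0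
    rw [inv_mul_le_iff₀ hC]
    exact h2.trans (mul_le_mul_of_nonneg_right (le_max_left _ _) (Real.sqrt_nonneg _))
  · have h1 : √Q ≤ C₂ * r := by
      rw [← Real.sqrt_sq hr.le, hC₂, ← Real.sqrt_mul (by positivity)]
      exact Real.sqrt_le_sqrt (hup.trans_eq (by ring))
    exact h1.trans (mul_le_mul_of_nonneg_right (le_max_right _ _) hr.le)

end QOT

theorem theorem2p3 (μ₀ μ₁ : Measure ℝ) [IsProbabilityMeasure μ₀] [IsProbabilityMeasure μ₁]
    (a₀ b₀ a₁ b₁ : ℝ)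
    (hμ₀ : QOT.HasRegularDensity μ₀ a₀ b₀) (hμ₁ : QOT.HasRegularDensity μ₁ a₁ b₁)
    (T₀ : ℝ → ℝ) (hT₀ : QOT.IsMongeMap μ₀ μ₁ T₀) :
    ∃ C : ℝ, 0 < C ∧ ∃ ε₀ : ℝ, 0 < ε₀ ∧ ∀ ε : ℝ, 0 < ε → ε < ε₀ →
      ∀ f g : ℝ → ℝ, QOT.IsPotentialPair μ₀ μ₁ (Icc a₀ b₀) (Icc a₁ b₁) ε f g →
        -- the Hausdorff distance of the sections to the Monge map, in `L²(Ω₀, dx)`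
        ((∀ x ∈ Icc a₀ b₀, (QOT.supportSection (Icc a₁ b₁) f g x).Nonempty) ∧
          MemLp (fun x => Metric.hausdorffDist (QOT.supportSection (Icc a₁ b₁) f g x) {T₀ x}) 2
            (volume.restrict (Icc a₀ b₀)) ∧
          ENNReal.ofReal (C⁻¹ * ε ^ (1 / 3 : ℝ)) ≤
            eLpNorm (fun x => Metric.hausdorffDist (QOT.supportSection (Icc a₁ b₁) f g x) {T₀ x}) 2
              (volume.restrict (Icc a₀ b₀)) ∧
          eLpNorm (fun x => Metric.hausdorffDist (QOT.supportSection (Icc a₁ b₁) f g x) {T₀ x}) 2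
              (volume.restrict (Icc a₀ b₀)) ≤
            ENNReal.ofReal (C * ε ^ (1 / 3 : ℝ))) ∧
        -- the derivative of the potential converges to the Monge map
        (DifferentiableOn ℝ f (Icc a₀ b₀) ∧
          MemLp (fun x => derivWithin f (Icc a₀ b₀) x - T₀ x) 2 (volume.restrict (Icc a₀ b₀)) ∧
          eLpNorm (fun x => derivWithin f (Icc a₀ b₀) x - T₀ x) 2 (volume.restrict (Icc a₀ b₀)) ≤
            ENNReal.ofReal (C * ε ^ (1 / 3 : ℝ))) := by
  obtain ⟨u₀, lo₀, hi₀, h₀⟩ := hμ₀.exists_regularDensity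
  obtain ⟨u₁, lo₁, hi₁, h₁⟩ := hμ₁.exists_regularDensity
  obtain ⟨T, R, hTR, hT⟩ := QOT.exists_monotone_rearrangement h₀ h₁
  have hTc := hTR.continuous_map
  -- Agreement `μ₀`-a.e. becomes agreement Lebesgue-a.e. on the interval because the density is
  -- bounded below.
  have hTae : T₀ =ᵐ[volume.restrict (Icc a₀ b₀)] T :=
    h₀.absolutelyContinuous'.ae_le (QOT.isMongeMap_ae_eq h₀ h₁ hTR hT hT₀)
  obtain ⟨C, hC, hrate⟩ := QOT.exists_rate h₀ h₁ hTR hT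
  -- The threshold `1` ensures `r < 1`, which bounds the rounding in the number of blocks.
  refine ⟨C, hC, 1, one_pos, fun ε hε hε1 f g hfg => ?_⟩
  set r := ε ^ (1 / 3 : ℝ) with hrdef
  have hr : 0 < r := Real.rpow_pos_of_pos hε _
  have hr1 : r < 1 := Real.rpow_lt_one hε.le hε1 (by norm_num)
  have hr3 : r ^ 3 = ε := by
    rw [hrdef, ← Real.rpow_natCast, ← Real.rpow_mul hε.le]; norm_num
  obtain ⟨f', g', hf, hg, h⟩ := hfg.exists_regularPotentials h₀ h₁ hε
  have hsec : ∀ x ∈ Icc a₀ b₀,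
      QOT.supportSection (Icc a₁ b₁) f g x = QOT.supportSection (Icc a₁ b₁) f' g' x :=
    fun x hx => by
      ext y
      refine and_congr_right fun hy => ?_
      rw [hf hx, hg hy]
  have hne : ∀ x ∈ Icc a₀ b₀, (QOT.supportSection (Icc a₁ b₁) f' g' x).Nonempty :=
    fun x hx => QOT.nonempty_supportSection h₁ hε h hx
  have hLp := QOT.memLp_sectionDist h.continuous_left h.continuous_right hTc hne
  obtain ⟨hlow, hup⟩ := hrate r hr hr1 f' g' (hr3.symm ▸ h)
  have hdist : (fun x => Metric.hausdorffDist (QOT.supportSection (Icc a₁ b₁) f g x) {T₀ x})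
      =ᵐ[volume.restrict (Icc a₀ b₀)] QOT.sectionDist a₁ b₁ f' g' T := by
    filter_upwards [hTae, ae_restrict_mem measurableSet_Icc] with x hx hxI
    rw [hsec x hxI, hx]; rfl
  have hderiv : ∀ x ∈ Icc a₀ b₀,
      HasDerivWithinAt f (QOT.barycenter μ₁ f' g' x) (Icc a₀ b₀) x := fun x hx =>
    (h.hasDerivWithinAt x hx).congr hf (hf hx)
  have hder : (fun x => derivWithin f (Icc a₀ b₀) x - T₀ x)
      =ᵐ[volume.restrict (Icc a₀ b₀)] fun x => QOT.barycenter μ₁ f' g' x - T x := by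
    filter_upwards [hTae, ae_restrict_mem measurableSet_Icc] with x hx hxI
    rw [hx, (hderiv x hxI).derivWithin (uniqueDiffOn_Icc h₀.lt x hxI)]
  have hmeas : AEStronglyMeasurable (fun x => QOT.barycenter μ₁ f' g' x - T x)
      (volume.restrict (Icc a₀ b₀)) :=
    (h.continuousOn_barycenter.sub hTc.continuousOn).aestronglyMeasurable measurableSet_Icc
  have hle : ∀ᵐ x ∂(volume.restrict (Icc a₀ b₀)),
      ‖QOT.barycenter μ₁ f' g' x - T x‖ ≤ ‖QOT.sectionDist a₁ b₁ f' g' T x‖ := by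
    filter_upwards [ae_restrict_mem measurableSet_Icc] with x hx
    exact (QOT.abs_barycenter_sub_le h₁ hε h hx).trans (le_abs_self _)
  have hupE : eLpNorm (QOT.sectionDist a₁ b₁ f' g' T) 2 (volume.restrict (Icc a₀ b₀)) ≤
      ENNReal.ofReal (C * r) := by
    rw [QOT.eLpNorm_two_eq hLp]; exact ENNReal.ofReal_le_ofReal hup
  refine ⟨⟨fun x hx => hsec x hx ▸ hne x hx, (memLp_congr_ae hdist).2 hLp, ?_, ?_⟩,
    fun x hx => (hderiv x hx).differentiableWithinAt,
    (memLp_congr_ae hder).2 (hLp.mono hmeas hle), ?_⟩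
  · rw [eLpNorm_congr_ae hdist, QOT.eLpNorm_two_eq hLp]
    exact ENNReal.ofReal_le_ofReal hlow
  · rwa [eLpNorm_congr_ae hdist]
  · rw [eLpNorm_congr_ae hder]
    exact (eLpNorm_mono_ae hle).trans hupE
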